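/- \textbf{Setting.} Let $(X,A,Y,Y^0,Y^1,W)$ be random variables on a probability space, with covariates $X\in\mathbb{R}^d$, exposure $A\in\{0,1\}$, outcome $Y\in\mathbb{R}$, integrable potential outcomes $Y^0,Y^1\in\mathbb{R}$, and unmeasured confounders $W$ in a (nonempty) standard Borel space. For $S\subseteq[d]$, $X_{-S}$ denotes $X$ without the coordinates in $S$, and $X_{-j}=X_{-\{j\}}$. For a sub-vector $V$ of the variables, write $\pi_a(V)=\mathbb{P}(A=a\mid V)$, $\mu_a(V)=\mathbb{E}(Y\mid A=a,V)$, $\psi_*=\mathbb{E}(Y^1-Y^0)$ (the average treatment effect, ATE), $\psi=\mathbb{E}\{\mu_1(X)-\mu_0(X)\}$, $\psi_{-j}=\mathbb{E}\{\mu_1(X_{-j})-\mu_0(X_{-j})\}$, $\|f\|_2^2=\mathbb{E}(f^2)$ and $\mathrm{odds}(p)=p/(1-p)\in[0,\infty]$. Maxima over an empty index set are $0$. Assume consistency ($A=a\Rightarrow Y=Y^a$, almost surely) and positivity (there is $\varepsilon>0$ with $\varepsilon\le\pi_1(X)\le1-\varepsilon$ almost surely). Let $\Gamma\in(0,\infty)$.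 \textbf{Proposition (partial identification).} (i) \emph{Effect differences model.} The model $|\psi_*-\psi|\le\Gamma\max_{j\in[d]}|\psi-\psi_{-j}|$ holds if and only if $$\psi-\Gamma\max_{j\in[d]}|\psi-\psi_{-j}|\ \le\ \psi_*\ \le\ \psi+\Gamma\max_{j\in[d]}|\psi-\psi_{-j}|.$$ (ii) \emph{Odds ratio model.} Let $$M=\max_{j\in[d]}\ \sup_{x_{-j},x_j,\tilde x_j}\left|\log\frac{\mathrm{odds}\{\pi_1(x_{-j},x_j)\}}{\mathrm{odds}\{\pi_1(x_{-j},\tilde x_j)\}}\right|,\qquad U=\sup_{x,w,\tilde w}\left|\log\frac{\mathrm{odds}\{\pi_1(x,w)\}}{\mathrm{odds}\{\pi_1(x,\tilde w)\}}\right|,$$ where the suprema are essential: $x_{-j}$ has the law of $X_{-j}$ and, given it, $x_j,\tilde x_j$ are independent draws from the conditional law of $X_j$ given $X_{-j}=x_{-j}$; likewise $x$ has the law of $X$ and, given it, $w,\tilde w$ are independent draws from the conditional law of $W$ given $X=x$. (The absolute log odds ratio is read as $\infty$ if one of the two probabilities is $0$ or $1$.) For $t\ge1$ let $$\theta_a^-(x;t)=\inf_{L}\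 \mathbb{E}\{YL(Y)\mid A=a,X=x\},\qquad \theta_a^+(x;t)=\sup_{L}\ \mathbb{E}\{YL(Y)\mid A=a,X=x\},$$ over all measurable $L:\mathbb{R}\to\mathbb{R}$ with $0\le L(y)\le tL(\tilde y)$ for all $y,\tilde y$ and $\mathbb{E}\{L(Y)\mid A=a,X=x\}=1$. Then $M<\infty$, the random variables inside the expectations below are integrable, and, if $(Y^0,Y^1)$ is conditionally independent of $A$ given $(X,W)$ and $U\le\Gamma M$, then $\mathcal{L}\le\psi_*\le\mathcal{U}$, where $$\mathcal{L}=\mathbb{E}\Big[AY+(1-A)\theta_1^-\{X;e^{\Gamma M}\}-\Big\{(1-A)Y+A\,\theta_0^+\{X;e^{\Gamma M}\}\Big\}\Big],$$ $$\mathcal{U}=\mathbb{E}\Big[AY+(1-A)\theta_1^+\{X;e^{\Gamma M}\}-\Big\{(1-A)Y+A\,\theta_0^-\{X;e^{\Gamma M}\}\Big\}\Big].$$ (iii) \emph{Average leave-some-out outcome model.} Let $\mathcal{S}$ be a nonempty set of subsets of $[d]$ and, for $a\in\{0,1\}$, let $$M_a^2=\frac1{|\mathcal{S}|}\sum_{S\in\mathcal{S}}\Big\|\mu_a(X_{-S})-\mathbb{E}\{\mu_a(X)\mid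 A=1-a,X_{-S}\}\Big\|_2^2\in[0,\infty],\qquad U_a=\Big\|\mathbb{E}(Y^a\mid A=a,X)-\mathbb{E}(Y^a\mid A=1-a,X)\Big\|_2 .$$ If $U_a^2\le\Gamma M_a^2$ for $a\in\{0,1\}$, then $$\psi-\sqrt{\Gamma}\sum_{a\in\{0,1\}}\|\pi_{1-a}(X)\|_2\,M_a\ \le\ \psi_*\ \le\ \psi+\sqrt{\Gamma}\sum_{a\in\{0,1\}}\|\pi_{1-a}(X)\|_2\,M_a .$$ If the model is imposed on the norms instead of their squares, i.e. $U_a\le\Gamma M_a$ (equivalently $U_a^2\le\Gamma^2M_a^2$) for $a\in\{0,1\}$, then $$\psi-\Gamma\sum_{a\in\{0,1\}}\|\pi_{1-a}(X)\|_2\,M_a\ \le\ \psi_*\ \le\ \psi+\Gamma\sum_{a\in\{0,1\}}\|\pi_{1-a}(X)\|_2\,M_a .$$ (If some $M_a=\infty$, the bounds are $-\infty$ and $+\infty$.) -/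

import Mathlib

open MeasureTheory ProbabilityTheory
open scoped ENNReal

noncomputable section

namespace CalibratedSensitivity

/-! Throughout, `P` is the probability measure on the sample space `Ω`, `X : Ω → ℝ^d` are the
covariates, `A : Ω → {0, 1}` is the exposure, `Y : Ω → ℝ` is the outcome, and `Ypot a` is the
potential outcome `Y^a` under exposure `a`. In `Fin 2`, `1 - a` is the exposure opposite
to `a`. -/

section Nuisance

variable {Ω 𝓥 : Type*} [MeasurableSpace Ω] [MeasurableSpace 𝓥]

/-- The covariates `X_{-S}`: the vector `X` without the coordinates in `S`. -/
def drop {d : ℕ} (X : Ω → Fin d → ℝ) (S : Finset (Fin d)) (ω : Ω) : {i : Fin d // i ∉ S} → ℝ :=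
  fun i => X ω i

/-- The propensity score `π_a(v) = P(A = a | V = v)`. -/
def propensity (P : Measure Ω) [IsProbabilityMeasure P] (A : Ω → Fin 2) (V : Ω → 𝓥) (a : Fin 2)
    (v : 𝓥) : ℝ :=
  (condDistrib A V P v).real {a}

/-- The conditional law of `T` given `A = a` and `V = v`. -/
def condLaw (P : Measure Ω) [IsProbabilityMeasure P] (A : Ω → Fin 2) (V : Ω → 𝓥) (T : Ω → ℝ)
    (a : Fin 2) (v : 𝓥) : Measure ℝ :=
  condDistrib T (fun ω => (A ω, V ω)) P (a, v)

/-- The conditional mean `E(T | A = a, V = v)`. With `T = Y` it is the outcome regression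
`μ_a(v)` for the covariates `V`. -/
def condMean (P : Measure Ω) [IsProbabilityMeasure P] (A : Ω → Fin 2) (V : Ω → 𝓥) (T : Ω → ℝ)
    (a : Fin 2) (v : 𝓥) : ℝ :=
  ∫ y, y ∂(condLaw P A V T a v)

/-- The adjusted mean difference `E{μ_1(V) - μ_0(V)}` for the covariates `V`. With `V = X` it is
`ψ`, with `V = X_{-S}` it is `ψ_{-S}`. -/
def adjDiff (P : Measure Ω) [IsProbabilityMeasure P] (A : Ω → Fin 2) (V : Ω → 𝓥) (Y : Ω → ℝ) : ℝ :=
  ∫ ω, (condMean P A V Y 1 (V ω) - condMean P A V Y 0 (V ω)) ∂P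

/-- The average treatment effect `ψ_* = E(Y^1 - Y^0)`. -/
def ate (P : Measure Ω) (Ypot : Fin 2 → Ω → ℝ) : ℝ :=
  ∫ ω, (Ypot 1 ω - Ypot 0 ω) ∂P

/-- Consistency: almost surely, `A = a` implies `Y = Y^a`. -/
def Consistency (P : Measure Ω) (A : Ω → Fin 2) (Y : Ω → ℝ) (Ypot : Fin 2 → Ω → ℝ) : Prop :=
  ∀ᵐ ω ∂P, ∀ a, A ω = a → Y ω = Ypot a ω

/-- Positivity: for some `ε > 0`, almost surely `ε ≤ π_1(X) ≤ 1 - ε`. -/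
def Positivity (P : Measure Ω) [IsProbabilityMeasure P] (A : Ω → Fin 2) (X : Ω → 𝓥) : Prop :=
  ∃ ε : ℝ, 0 < ε ∧
    ∀ᵐ ω ∂P, ε ≤ propensity P A X 1 (X ω) ∧ propensity P A X 1 (X ω) ≤ 1 - ε

end Nuisance

section Effect

variable {Ω : Type*} [MeasurableSpace Ω] {d : ℕ}

/-- Measured confounding in the effect differences model: `max_{j ∈ [d]} |ψ - ψ_{-j}|`
(for `d = 0`, the maximum over the empty set is `0`). -/
def effectConfounding (P : Measure Ω) [IsProbabilityMeasure P] (X : Ω → Fin d → ℝ)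
    (A : Ω → Fin 2) (Y : Ω → ℝ) : ℝ :=
  ⨆ j : Fin d, |adjDiff P A X Y - adjDiff P A (drop X {j}) Y|

/-- The maximum leave-one-out effect differences model. -/
def EffectModel (P : Measure Ω) [IsProbabilityMeasure P] (X : Ω → Fin d → ℝ)
    (A : Ω → Fin 2) (Y : Ω → ℝ) (Ypot : Fin 2 → Ω → ℝ) (Γ : ℝ) : Prop :=
  |ate P Ypot - adjDiff P A X Y| ≤ Γ * effectConfounding P X A Y

end Effect

section Odds

/-- The odds `p / (1 - p)` of a probability, in `[0, ∞]`, so that `p = 1` has odds `∞`. -/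
def odds (p : ℝ) : ℝ≥0∞ := ENNReal.ofReal p / ENNReal.ofReal (1 - p)

/-- `|log (odds p / odds q)|` in `[0, ∞]`; it is `∞` whenever `p` or `q` is `0` or `1`. -/
def absLogOddsRatio (p q : ℝ) : ℝ≥0∞ := (ENNReal.log (odds p / odds q)).abs

variable {Ω 𝓥 𝓡 : Type*} [MeasurableSpace Ω] [MeasurableSpace 𝓥]

/-- `sup_{v, r, r'} |log [odds{π_1(v, r)} / odds{π_1(v, r')}]|`: the largest log odds ratio of the
propensity score `π_1(v, r) = P(A = 1 | V = v, R = r)` between two values `r, r'` of `R` at the same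
value `v` of `V`. Since `π_1` is defined up to null sets only, the supremum is the essential one:
`v` is distributed as `V`, and given `v`, the values `r` and `r'` are independent draws from the
conditional law of `R` given `V = v`. -/
def oddsConfounding [MeasurableSpace 𝓡] [StandardBorelSpace 𝓡] [Nonempty 𝓡]
    (P : Measure Ω) [IsProbabilityMeasure P] (A : Ω → Fin 2) (V : Ω → 𝓥) (R : Ω → 𝓡) : ℝ≥0∞ :=
  essSup
    (fun z : 𝓥 × 𝓡 × 𝓡 =>
      absLogOddsRatio (propensity P A (fun ω => (V ω, R ω)) 1 (z.1, z.2.1))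
        (propensity P A (fun ω => (V ω, R ω)) 1 (z.1, z.2.2)))
    ((P.map V) ⊗ₘ (condDistrib R V P ×ₖ condDistrib R V P))

variable {d : ℕ}

/-- Measured confounding `M` in the odds ratio model: the maximum over `j ∈ [d]` of the largest
log odds ratio of the propensity score between two values of `X_j` at the same value of `X_{-j}`. -/
def measuredOddsConfounding (P : Measure Ω) [IsProbabilityMeasure P] (X : Ω → Fin d → ℝ)
    (A : Ω → Fin 2) : ℝ≥0∞ :=
  ⨆ j : Fin d, oddsConfounding P A (drop X {j}) (fun ω => X ω j)

/-- `W` contains all confounders that `X` lacks: `(Y^0, Y^1)` and `A` are conditionally independent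
given `(X, W)`, that is, the conditional law of `((Y^0, Y^1), A)` given `(X, W)` is the product of
the two conditional laws. -/
def IsUnmeasuredConfounder [MeasurableSpace 𝓡] (P : Measure Ω) [IsProbabilityMeasure P]
    (X : Ω → Fin d → ℝ) (A : Ω → Fin 2) (Ypot : Fin 2 → Ω → ℝ) (W : Ω → 𝓡) : Prop :=
  P.map (fun ω => ((X ω, W ω), ((Ypot 0 ω, Ypot 1 ω), A ω))) =
    (P.map (fun ω => (X ω, W ω))) ⊗ₘ
      (condDistrib (fun ω => (Ypot 0 ω, Ypot 1 ω)) (fun ω => (X ω, W ω)) P ×ₖ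
        condDistrib A (fun ω => (X ω, W ω)) P)

/-- The maximum leave-one-out propensity score odds ratio model, with unmeasured confounders `W`. -/
def OddsModel [MeasurableSpace 𝓡] [StandardBorelSpace 𝓡] [Nonempty 𝓡]
    (P : Measure Ω) [IsProbabilityMeasure P] (X : Ω → Fin d → ℝ) (A : Ω → Fin 2)
    (Ypot : Fin 2 → Ω → ℝ) (W : Ω → 𝓡) (Γ : ℝ) : Prop :=
  IsUnmeasuredConfounder P X A Ypot W ∧
    oddsConfounding P A X W ≤ ENNReal.ofReal Γ * measuredOddsConfounding P X A

/-- The class `𝕃` of measurable `L : ℝ → ℝ` with `0 ≤ L(y) ≤ t L(y')` for all `y, y'` and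
`∫ L dν = 1`. -/
def likelihoodRatios (ν : Measure ℝ) (t : ℝ) : Set (ℝ → ℝ) :=
  {L | Measurable L ∧ (∀ y y', 0 ≤ L y ∧ L y ≤ t * L y') ∧ ∫ y, L y ∂ν = 1}

/-- `θ_a^-(x; t) = inf {E{Y L(Y) | A = a, X = x} : L ∈ 𝕃}`. -/
def thetaMinus (P : Measure Ω) [IsProbabilityMeasure P] (X : Ω → Fin d → ℝ) (A : Ω → Fin 2)
    (Y : Ω → ℝ) (a : Fin 2) (t : ℝ) (x : Fin d → ℝ) : ℝ :=
  sInf ((fun L : ℝ → ℝ => ∫ y, y * L y ∂(condLaw P A X Y a x)) ''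
    likelihoodRatios (condLaw P A X Y a x) t)

/-- `θ_a^+(x; t) = sup {E{Y L(Y) | A = a, X = x} : L ∈ 𝕃}`. -/
def thetaPlus (P : Measure Ω) [IsProbabilityMeasure P] (X : Ω → Fin d → ℝ) (A : Ω → Fin 2)
    (Y : Ω → ℝ) (a : Fin 2) (t : ℝ) (x : Fin d → ℝ) : ℝ :=
  sSup ((fun L : ℝ → ℝ => ∫ y, y * L y ∂(condLaw P A X Y a x)) ''
    likelihoodRatios (condLaw P A X Y a x) t)

/-- The exposure as the real number `0` or `1`. -/
def expo (A : Ω → Fin 2) (ω : Ω) : ℝ := ((A ω : ℕ) : ℝ)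

/-- `A Y + (1 - A) θ_1^-(X; t) - {(1 - A) Y + A θ_0^+(X; t)}`. -/
def oddsLowerIntegrand (P : Measure Ω) [IsProbabilityMeasure P] (X : Ω → Fin d → ℝ)
    (A : Ω → Fin 2) (Y : Ω → ℝ) (t : ℝ) (ω : Ω) : ℝ :=
  expo A ω * Y ω + (1 - expo A ω) * thetaMinus P X A Y 1 t (X ω)
    - ((1 - expo A ω) * Y ω + expo A ω * thetaPlus P X A Y 0 t (X ω))

/-- `A Y + (1 - A) θ_1^+(X; t) - {(1 - A) Y + A θ_0^-(X; t)}`. -/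
def oddsUpperIntegrand (P : Measure Ω) [IsProbabilityMeasure P] (X : Ω → Fin d → ℝ)
    (A : Ω → Fin 2) (Y : Ω → ℝ) (t : ℝ) (ω : Ω) : ℝ :=
  expo A ω * Y ω + (1 - expo A ω) * thetaPlus P X A Y 1 t (X ω)
    - ((1 - expo A ω) * Y ω + expo A ω * thetaMinus P X A Y 0 t (X ω))

end Odds

section Outcome

variable {Ω : Type*} [MeasurableSpace Ω] {d : ℕ}

/-- Average leave-some-out measured confounding for exposure `a`:
`(1 / |𝒮|) ∑_{S ∈ 𝒮} ‖μ_a(X_{-S}) - E{μ_a(X) | A = 1 - a, X_{-S}}‖₂²`, in `[0, ∞]`. -/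
def outcomeConfounding (P : Measure Ω) [IsProbabilityMeasure P] (X : Ω → Fin d → ℝ)
    (A : Ω → Fin 2) (Y : Ω → ℝ) (𝒮 : Finset (Finset (Fin d))) (a : Fin 2) : ℝ≥0∞ :=
  (∑ S ∈ 𝒮,
    eLpNorm (fun ω => condMean P A (drop X S) Y a (drop X S ω)
      - condMean P A (drop X S) (fun ω' => condMean P A X Y a (X ω')) (1 - a) (drop X S ω)) 2 P ^ 2)
    / (𝒮.card : ℝ≥0∞)

/-- The average leave-some-out outcome model with multiplier `c`: for `a ∈ {0, 1}`,
`‖E(Y^a | A = a, X) - E(Y^a | A = 1 - a, X)‖₂²` is at most `c` times the average leave-some-out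
measured confounding. -/
def OutcomeModel (P : Measure Ω) [IsProbabilityMeasure P] (X : Ω → Fin d → ℝ)
    (A : Ω → Fin 2) (Y : Ω → ℝ) (Ypot : Fin 2 → Ω → ℝ) (𝒮 : Finset (Finset (Fin d)))
    (c : ℝ) : Prop :=
  ∀ a : Fin 2,
    eLpNorm (fun ω => condMean P A X (Ypot a) a (X ω) - condMean P A X (Ypot a) (1 - a) (X ω)) 2 P ^ 2
      ≤ ENNReal.ofReal c * outcomeConfounding P X A Y 𝒮 a

/-- `c ∑_a ‖π_{1-a}(X)‖₂ √(average leave-some-out measured confounding for a)`, in `[0, ∞]`. -/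
def outcomeRadius (P : Measure Ω) [IsProbabilityMeasure P] (X : Ω → Fin d → ℝ)
    (A : Ω → Fin 2) (Y : Ω → ℝ) (𝒮 : Finset (Finset (Fin d))) (c : ℝ) : ℝ≥0∞ :=
  ENNReal.ofReal c * ∑ a : Fin 2,
    eLpNorm (fun ω => propensity P A X (1 - a) (X ω)) 2 P
      * outcomeConfounding P X A Y 𝒮 a ^ (1 / 2 : ℝ)

end Outcome

end CalibratedSensitivity

end

open CalibratedSensitivity

/-! Part (i) is the rearrangement of an absolute value.

Part (ii) rests on a dual description of `θ^+`. With `t = e^{ΓM}`, the largest tilted mean of a law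
`ν` is the root `s` of `t ∫ (y - s)₊ dν = ∫ (s - y)₊ dν` (`isGreatest_of_tiltGap_eq_zero`). Take `s
= θ_a^+(x; t)`, `f = (y - s)₊`, `g = (s - y)₊`. Given `(X, W)`, the variables `Y^a` and `A` are
independent, so on either arm the conditional integral of `f` given `X = x` is the integral over `w`
of `π_b(x, w)` times one function `m_f(x, w)`; only the weight depends on the arm `b`. Write `p =
π_a`, `q = π_{1-a}`. The odds ratio bound says `q(w) p(w') ≤ t p(w) q(w')`; multiplying by `m_f(w)
m_g(w')` and integrating over independent `w, w'` gives `(∫ q m_f)(∫ p m_g) ≤ t (∫ p m_f)(∫ q m_g)`.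
On the observed arm `t ∫ p m_f = ∫ p m_g`, and cancelling leaves `∫ q m_f ≤ ∫ q m_g`
(`lintegral_le_of_cross_le`). Hence `Y^a - θ_a^+` has nonpositive integral over the unobserved arm.
No likelihood ratio between the two laws of `Y^a` has to be constructed. Reflection handles `θ^-`,
and the two arms together bound the effect.

In part (iii), `E(Y^a) - E{μ_a(X)}` is minus the mean of `π_{1-a}(X)` times the difference of the
conditional means of `Y^a` on the two arms. Cauchy–Schwarz and the square root of the model bound
it. -/

noncomputable section

namespace CalibratedSensitivity

/-! ### Disintegration of `(V, T)` on the event `A = a`. -/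

section Arms

variable {Ω 𝓥 : Type*} [MeasurableSpace Ω] [MeasurableSpace 𝓥] {P : Measure Ω}
  [IsProbabilityMeasure P] {A : Ω → Fin 2} {V : Ω → 𝓥} {T T' : Ω → ℝ}

/-- The conditional laws of `T` given `A = a` and `V = v`, as a kernel in `v`. -/
def armKernel (P : Measure Ω) [IsProbabilityMeasure P] (A : Ω → Fin 2) (V : Ω → 𝓥) (T : Ω → ℝ)
    (a : Fin 2) : Kernel 𝓥 ℝ :=
  (condDistrib T (fun ω => (A ω, V ω)) P).comap (fun v => (a, v)) measurable_prodMk_left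

lemma armKernel_apply (a : Fin 2) (v : 𝓥) : armKernel P A V T a v = condLaw P A V T a v := rfl

instance (a : Fin 2) : IsMarkovKernel (armKernel P A V T a) := by
  unfold armKernel; infer_instance

instance (a : Fin 2) (v : 𝓥) : IsProbabilityMeasure (condLaw P A V T a v) := by
  unfold condLaw; infer_instance

lemma measurable_lintegral_condLaw {f : 𝓥 × ℝ → ℝ≥0∞} (hf : Measurable f) (a : Fin 2) :
    Measurable fun v => ∫⁻ y, f (v, y) ∂condLaw P A V T a v :=
  hf.lintegral_kernel_prod_right' (κ := armKernel P A V T a)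

lemma stronglyMeasurable_condMean (a : Fin 2) : StronglyMeasurable (condMean P A V T a) :=
  StronglyMeasurable.integral_kernel_prod_right' (κ := armKernel P A V T a)
    (f := fun z : 𝓥 × ℝ => z.2) measurable_snd.stronglyMeasurable

lemma measurable_propensity (a : Fin 2) : Measurable (propensity P A V a) :=
  (Kernel.measurable_coe _ (measurableSet_singleton a)).ennreal_toReal

lemma ofReal_propensity (a : Fin 2) (v : 𝓥) :
    ENNReal.ofReal (propensity P A V a v) = condDistrib A V P v {a} :=
  ENNReal.ofReal_toReal (measure_ne_top _ _)

lemma propensity_nonneg (a : Fin 2) (v : 𝓥) : 0 ≤ propensity P A V a v := measureReal_nonneg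

lemma propensity_add (a : Fin 2) (v : 𝓥) :
    propensity P A V a v + propensity P A V (1 - a) v = 1 := by
  have h : propensity P A V 0 v + propensity P A V 1 v = 1 := by
    unfold propensity
    rw [← measureReal_union (by simp) (measurableSet_singleton _)]
    convert probReal_univ (μ := condDistrib A V P v)
    ext i; fin_cases i <;> simp
  fin_cases a
  · simpa using h
  · simpa [add_comm] using h

lemma propensity_le_one (a : Fin 2) (v : 𝓥) : propensity P A V a v ≤ 1 := measureReal_le_one

/-- The law of `((A, V), T)` is disintegrated along `(A, V)`, then that of `(V, A)` along `V`; only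
the atom `a` of the finite inner sum survives. No positivity is needed: where the propensity
vanishes, the arbitrary value of the conditional law is multiplied by `0`. -/
lemma setLIntegral_arm (hA : Measurable A) (hV : Measurable V) (hT : Measurable T) (a : Fin 2)
    {f : 𝓥 × ℝ → ℝ≥0∞} (hf : Measurable f) :
    ∫⁻ ω in A ⁻¹' {a}, f (V ω, T ω) ∂P =
      ∫⁻ v, condDistrib A V P v {a} * ∫⁻ y, f (v, y) ∂condLaw P A V T a v ∂P.map V := by
  let g : (Fin 2 × 𝓥) × ℝ → ℝ≥0∞ := fun z => ({a} : Set (Fin 2)).indicator 1 z.1.1 * f (z.1.2, z.2)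
  have h1 : Measurable (({a} : Set (Fin 2)).indicator (1 : Fin 2 → ℝ≥0∞)) := measurable_of_finite _
  have hg : Measurable g := by fun_prop
  have hF : Measurable fun z : Fin 2 × 𝓥 =>
      ∫⁻ y, g (z, y) ∂condDistrib T (fun ω => (A ω, V ω)) P z :=
    hg.lintegral_kernel_prod_right'
  have hF' : Measurable fun z : 𝓥 × Fin 2 =>
      ∫⁻ y, g ((z.2, z.1), y) ∂condDistrib T (fun ω => (A ω, V ω)) P (z.2, z.1) :=
    hF.comp measurable_swap
  calc ∫⁻ ω in A ⁻¹' {a}, f (V ω, T ω) ∂P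
      = ∫⁻ ω, g ((A ω, V ω), T ω) ∂P := by
        rw [← lintegral_indicator (hA (measurableSet_singleton a))]
        refine lintegral_congr fun ω => ?_
        by_cases h : A ω = a <;> simp [g, h]
    _ = ∫⁻ z, g z ∂P.map (fun ω => ((A ω, V ω), T ω)) := by
        rw [lintegral_map hg (by fun_prop)]
    _ = ∫⁻ ω, ∫⁻ y, g ((A ω, V ω), y) ∂condDistrib T (fun ω => (A ω, V ω)) P (A ω, V ω) ∂P := by
        rw [← compProd_map_condDistrib hT.aemeasurable, Measure.lintegral_compProd hg,
          lintegral_map hF (by fun_prop)]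
    _ = ∫⁻ z, (fun z : 𝓥 × Fin 2 =>
          ∫⁻ y, g ((z.2, z.1), y) ∂condDistrib T (fun ω => (A ω, V ω)) P (z.2, z.1)) z
            ∂P.map (fun ω => (V ω, A ω)) := by
        rw [lintegral_map hF' (by fun_prop)]
    _ = ∫⁻ v, condDistrib A V P v {a} * ∫⁻ y, f (v, y) ∂condLaw P A V T a v ∂P.map V := by
        rw [← compProd_map_condDistrib hA.aemeasurable,
          Measure.lintegral_compProd hF']
        refine lintegral_congr fun v => ?_
        rw [lintegral_fintype, Finset.sum_eq_single a]
        · simp [g, condLaw, mul_comm]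
        · intro b _ hb
          simp [g, hb]
        · simp

/-- The law of `(V, T)` on the event `A = a`. -/
lemma map_restrict_arm (hA : Measurable A) (hV : Measurable V) (hT : Measurable T) (a : Fin 2) :
    (P.restrict (A ⁻¹' {a})).map (fun ω => (V ω, T ω)) =
      ((P.map V).withDensity fun v => condDistrib A V P v {a}) ⊗ₘ armKernel P A V T a := by
  have hm : Measurable fun v => condDistrib A V P v {a} :=
    Kernel.measurable_coe _ (measurableSet_singleton a)
  have : IsFiniteMeasure ((P.map V).withDensity fun v => condDistrib A V P v {a}) := by
    have := Measure.isProbabilityMeasure_map (μ := P) hV.aemeasurable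
    refine isFiniteMeasure_withDensity (ne_top_of_le_ne_top ENNReal.one_ne_top ?_)
    calc _ ≤ ∫⁻ _, 1 ∂P.map V := lintegral_mono fun v => prob_le_one
      _ = 1 := by simp
  refine Measure.ext_of_lintegral _ fun f hf => ?_
  rw [lintegral_map hf (by fun_prop), setLIntegral_arm hA hV hT a hf,
    Measure.lintegral_compProd hf]
  simp only [armKernel_apply]
  rw [lintegral_withDensity_eq_lintegral_mul _ hm (measurable_lintegral_condLaw hf a)]
  rfl

/-- Uniqueness of conditional integrals on an arm. -/
lemma ae_eq_of_setLIntegral_arm (hA : Measurable A) (hV : Measurable V) (hT : Measurable T)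
    (a : Fin 2) {f : 𝓥 × ℝ → ℝ≥0∞} (hf : Measurable f) {g : 𝓥 → ℝ≥0∞} (hg : Measurable g)
    (h : ∀ s, MeasurableSet s →
      ∫⁻ ω in A ⁻¹' {a}, s.indicator 1 (V ω) * f (V ω, T ω) ∂P = ∫⁻ v in s, g v ∂P.map V) :
    ∀ᵐ v ∂P.map V, condDistrib A V P v {a} * ∫⁻ y, f (v, y) ∂condLaw P A V T a v = g v := by
  have hm : Measurable fun v => condDistrib A V P v {a} :=
    Kernel.measurable_coe _ (measurableSet_singleton a)
  have := Measure.isProbabilityMeasure_map (μ := P) hV.aemeasurable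
  refine ae_eq_of_forall_setLIntegral_eq_of_sigmaFinite
    (hm.mul (measurable_lintegral_condLaw hf a)) hg fun s hs _ => ?_
  have h1 : Measurable (s.indicator (1 : 𝓥 → ℝ≥0∞)) := measurable_one.indicator hs
  rw [← h s hs, setLIntegral_arm hA hV hT a (f := fun z => s.indicator 1 z.1 * f z) (by fun_prop),
    ← lintegral_indicator hs]
  refine lintegral_congr fun v => ?_
  by_cases hv : v ∈ s <;> simp [hv]

/-- The conditional law on an arm sees `T` only on that arm. Both sides agree after multiplication
by the propensity, which is cancelled because it is nonzero. With consistency, this lets `Y^a`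
replace `Y`. -/
lemma lintegral_condLaw_congr (hA : Measurable A) (hV : Measurable V) (hT : Measurable T)
    (hT' : Measurable T') (a : Fin 2) (h : ∀ᵐ ω ∂P, A ω = a → T ω = T' ω)
    (hne : ∀ᵐ v ∂P.map V, condDistrib A V P v {a} ≠ 0)
    {f : 𝓥 × ℝ → ℝ≥0∞} (hf : Measurable f) :
    ∀ᵐ v ∂P.map V,
      ∫⁻ y, f (v, y) ∂condLaw P A V T a v = ∫⁻ y, f (v, y) ∂condLaw P A V T' a v := by
  have hm : Measurable fun v => condDistrib A V P v {a} :=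
    Kernel.measurable_coe _ (measurableSet_singleton a)
  have h1 : ∀ᵐ v ∂P.map V, condDistrib A V P v {a} * ∫⁻ y, f (v, y) ∂condLaw P A V T a v
      = condDistrib A V P v {a} * ∫⁻ y, f (v, y) ∂condLaw P A V T' a v := by
    refine ae_eq_of_setLIntegral_arm hA hV hT a hf
      (hm.mul (measurable_lintegral_condLaw hf a)) fun s hs => ?_
    have h1 : Measurable (s.indicator (1 : 𝓥 → ℝ≥0∞)) := measurable_one.indicator hs
    trans ∫⁻ ω in A ⁻¹' {a}, s.indicator 1 (V ω) * f (V ω, T' ω) ∂P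
    · refine setLIntegral_congr_fun_ae (hA (measurableSet_singleton a)) ?_
      filter_upwards [h] with ω hω hωa
      rw [hω hωa]
    · rw [setLIntegral_arm hA hV hT' a (f := fun z => s.indicator 1 z.1 * f z) (by fun_prop),
        ← lintegral_indicator hs]
      refine lintegral_congr fun v => ?_
      by_cases hv : v ∈ s <;> simp [hv]
  filter_upwards [h1, hne] with v hv hv0
  exact (ENNReal.mul_right_inj hv0 (measure_ne_top _ _)).1 hv

/-- Agreement is known for integrals of nonnegative functions only. Equality of the absolute moments
makes the two means exist together, and then the positive and negative parts match; otherwise both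
means take the default value `0`. -/
lemma condMean_congr (hA : Measurable A) (hV : Measurable V) (hT : Measurable T)
    (hT' : Measurable T') (a : Fin 2) (h : ∀ᵐ ω ∂P, A ω = a → T ω = T' ω)
    (hne : ∀ᵐ v ∂P.map V, condDistrib A V P v {a} ≠ 0) :
    ∀ᵐ v ∂P.map V, condMean P A V T a v = condMean P A V T' a v := by
  filter_upwards [lintegral_condLaw_congr hA hV hT hT' a h hne
      (f := fun z => ENNReal.ofReal z.2) (by fun_prop),
    lintegral_condLaw_congr hA hV hT hT' a h hne
      (f := fun z => ENNReal.ofReal (-z.2)) (by fun_prop),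
    lintegral_condLaw_congr hA hV hT hT' a h hne
      (f := fun z => ENNReal.ofReal |z.2|) (by fun_prop)] with v h1 h2 h3
  have key : ∀ ν : Measure ℝ, Integrable (fun y => y) ν ↔ ∫⁻ y, ENNReal.ofReal |y| ∂ν < ∞ := by
    intro ν
    rw [← memLp_one_iff_integrable, MemLp, eLpNorm_one_eq_lintegral_enorm]
    simp only [← ofReal_norm, Real.norm_eq_abs]
    exact and_iff_right measurable_id.aestronglyMeasurable
  unfold condMean
  by_cases hi : Integrable (fun y => y) (condLaw P A V T a v)
  · have hi' : Integrable (fun y => y) (condLaw P A V T' a v) := by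
      rw [key] at hi ⊢; rwa [← h3]
    rw [integral_eq_lintegral_pos_part_sub_lintegral_neg_part hi,
      integral_eq_lintegral_pos_part_sub_lintegral_neg_part hi', h1, h2]
  · have hi' : ¬ Integrable (fun y => y) (condLaw P A V T' a v) := by
      rw [key] at hi ⊢; rwa [← h3]
    rw [integral_undef hi, integral_undef hi']

/-- Conditional integrability on an arm. -/
lemma ae_integrable_condLaw (hA : Measurable A) (hV : Measurable V) (hT : Measurable T) (a : Fin 2)
    (hi : Integrable T (P.restrict (A ⁻¹' {a})))
    (hne : ∀ᵐ v ∂P.map V, condDistrib A V P v {a} ≠ 0) :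
    ∀ᵐ v ∂P.map V, Integrable (fun y => y) (condLaw P A V T a v) := by
  have hm : Measurable fun v => condDistrib A V P v {a} :=
    Kernel.measurable_coe _ (measurableSet_singleton a)
  have := Measure.isProbabilityMeasure_map (μ := P) hV.aemeasurable
  have h0 : ∫⁻ v, condDistrib A V P v {a} * ∫⁻ y, ENNReal.ofReal |y| ∂condLaw P A V T a v ∂P.map V
      ≠ ∞ := by
    rw [← setLIntegral_arm hA hV hT a (f := fun z => ENNReal.ofReal |z.2|) (by fun_prop)]
    have := hi.2
    simp only [HasFiniteIntegral, ← ofReal_norm, Real.norm_eq_abs] at this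
    exact this.ne
  filter_upwards [hne, ae_lt_top (hm.mul (measurable_lintegral_condLaw
    (f := fun z => ENNReal.ofReal |z.2|) (by fun_prop) a)) h0] with v hv hv'
  refine ⟨measurable_id.aestronglyMeasurable, ?_⟩
  simp only [HasFiniteIntegral, ← ofReal_norm, Real.norm_eq_abs]
  by_contra hc
  rw [not_lt, top_le_iff] at hc
  simp only [Pi.mul_apply, hc, ENNReal.mul_top hv, lt_self_iff_false] at hv'

lemma setIntegral_arm (hA : Measurable A) (hV : Measurable V) (hT : Measurable T) (a : Fin 2)
    (hi : Integrable T (P.restrict (A ⁻¹' {a}))) :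
    ∫ ω in A ⁻¹' {a}, T ω ∂P = ∫ ω, propensity P A V a (V ω) * condMean P A V T a (V ω) ∂P := by
  have hm : Measurable fun v => condDistrib A V P v {a} :=
    Kernel.measurable_coe _ (measurableSet_singleton a)
  have : IsFiniteMeasure ((P.map V).withDensity fun v => condDistrib A V P v {a}) := by
    have := Measure.isProbabilityMeasure_map (μ := P) hV.aemeasurable
    refine isFiniteMeasure_withDensity (ne_top_of_le_ne_top ENNReal.one_ne_top ?_)
    calc _ ≤ ∫⁻ _, 1 ∂P.map V := lintegral_mono fun v => prob_le_one
      _ = 1 := by simp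
  have hVT : Measurable fun ω => (V ω, T ω) := by fun_prop
  have h2 : AEStronglyMeasurable (fun z : 𝓥 × ℝ => z.2)
      ((P.restrict (A ⁻¹' {a})).map fun ω => (V ω, T ω)) := measurable_snd.aestronglyMeasurable
  have hi2 := (integrable_map_measure h2 hVT.aemeasurable).2 hi
  have h3 := integral_map hVT.aemeasurable h2
  rw [map_restrict_arm hA hV hT a] at h3 hi2
  rw [← h3, Measure.integral_compProd hi2,
    integral_withDensity_eq_integral_toReal_smul hm (ae_of_all _ fun v => measure_lt_top _ _),
    integral_map hV.aemeasurable]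
  · rfl
  · exact (hm.ennreal_toReal.stronglyMeasurable.smul
      (stronglyMeasurable_condMean a)).aestronglyMeasurable

end Arms

/-! ### Consequences of positivity: nonzero propensities and integrable conditional means. -/

section Positive

variable {Ω 𝓥 : Type*} [MeasurableSpace Ω] [MeasurableSpace 𝓥] {P : Measure Ω}
  [IsProbabilityMeasure P] {A : Ω → Fin 2} {V : Ω → 𝓥} {T : Ω → ℝ}

lemma Positivity.exists_le_propensity (h : Positivity P A V) (hV : Measurable V) :
    ∃ ε : ℝ, 0 < ε ∧ ∀ᵐ v ∂P.map V, ∀ a, ε ≤ propensity P A V a v := by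
  obtain ⟨ε, hε, h⟩ := h
  refine ⟨ε, hε, ?_⟩
  rw [ae_map_iff hV.aemeasurable (by
    simp only [Set.ofPred_forall]
    exact MeasurableSet.iInter fun a => measurableSet_le measurable_const (measurable_propensity a))]
  filter_upwards [h] with ω hω a
  have h1 := propensity_add (P := P) (A := A) (V := V) 1 (V ω)
  fin_cases a
  · simp at h1 ⊢; linarith [hω.2]
  · exact hω.1

lemma Positivity.ne_zero (h : Positivity P A V) (hV : Measurable V) (a : Fin 2) :
    ∀ᵐ v ∂P.map V, condDistrib A V P v {a} ≠ 0 := by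
  obtain ⟨ε, hε, h⟩ := h.exists_le_propensity hV
  filter_upwards [h] with v hv
  rw [← ofReal_propensity]
  exact (ENNReal.ofReal_pos.2 (hε.trans_le (hv a))).ne'

/-- The conditional absolute mean on an arm is integrable. -/
lemma Positivity.integrable_condLaw_abs (h : Positivity P A V) (hA : Measurable A)
    (hV : Measurable V) (hT : Measurable T) (a : Fin 2)
    (hi : Integrable T (P.restrict (A ⁻¹' {a}))) :
    Integrable (fun ω => ∫ y, |y| ∂condLaw P A V T a (V ω)) P := by
  obtain ⟨ε, hε, hp⟩ := h.exists_le_propensity hV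
  have hsm : StronglyMeasurable fun v => ∫ y, |y| ∂condLaw P A V T a v :=
    StronglyMeasurable.integral_kernel_prod_right' (κ := armKernel P A V T a)
      (f := fun z : 𝓥 × ℝ => |z.2|) (by fun_prop : Measurable _).stronglyMeasurable
  refine ⟨(hsm.measurable.comp hV).aestronglyMeasurable, ?_⟩
  rw [HasFiniteIntegral]
  -- The arm integral carries the weight `P(A = a | V) ≥ ε`; removing it costs the factor `ε⁻¹`.
  have hle : ∫⁻ ω, ‖∫ y, |y| ∂condLaw P A V T a (V ω)‖ₑ ∂P ≤
      ENNReal.ofReal ε⁻¹ * ∫⁻ ω in A ⁻¹' {a}, ‖T ω‖ₑ ∂P := by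
    have e : ∫⁻ ω in A ⁻¹' {a}, ‖T ω‖ₑ ∂P = _ :=
      setLIntegral_arm hA hV hT a (f := fun z => ‖z.2‖ₑ) (by fun_prop)
    have e2 : Measurable fun v => ∫⁻ y, ‖y‖ₑ ∂condLaw P A V T a v :=
      measurable_lintegral_condLaw (f := fun z => ‖z.2‖ₑ) (by fun_prop) a
    rw [e, ← lintegral_const_mul' _ _ ENNReal.ofReal_ne_top,
      ← lintegral_map (f := fun v => ‖∫ y, |y| ∂condLaw P A V T a v‖ₑ) hsm.measurable.enorm hV]
    refine lintegral_mono_ae ?_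
    filter_upwards [hp] with v hv
    rw [← mul_assoc, ← ofReal_propensity, ← ENNReal.ofReal_mul (by positivity)]
    calc ‖∫ y, |y| ∂condLaw P A V T a v‖ₑ ≤ ∫⁻ y, ‖|y|‖ₑ ∂condLaw P A V T a v :=
          enorm_integral_le_lintegral_enorm _
      _ = 1 * ∫⁻ y, ‖y‖ₑ ∂condLaw P A V T a v := by
          rw [one_mul]
          exact lintegral_congr fun y => by simp [← ofReal_norm]
      _ ≤ _ := by
          gcongr
          rw [ENNReal.one_le_ofReal, inv_mul_eq_div, one_le_div hε]
          exact hv a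
  exact hle.trans_lt (ENNReal.mul_lt_top ENNReal.ofReal_lt_top hi.2)

lemma Positivity.integrable_condMean (h : Positivity P A V) (hA : Measurable A)
    (hV : Measurable V) (hT : Measurable T) (a : Fin 2)
    (hi : Integrable T (P.restrict (A ⁻¹' {a}))) :
    Integrable (fun ω => condMean P A V T a (V ω)) P := by
  refine (h.integrable_condLaw_abs hA hV hT a hi).mono'
    ((stronglyMeasurable_condMean a).measurable.comp hV).aestronglyMeasurable (ae_of_all _ fun ω => ?_)
  exact norm_integral_le_integral_norm _

end Positive

/-! ### The extremal tilted means as roots of an asymmetric loss derivative. -/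

section Extremal

/-- The largest mean of `y` under reweightings of `ν` by likelihood ratios of spread at most `t`. -/
def maxTiltedMean (ν : Measure ℝ) (t : ℝ) : ℝ :=
  sSup ((fun L : ℝ → ℝ => ∫ y, y * L y ∂ν) '' likelihoodRatios ν t)

/-- The smallest mean of `y` under reweightings of `ν` by likelihood ratios of spread at most
`t`. -/
def minTiltedMean (ν : Measure ℝ) (t : ℝ) : ℝ :=
  sInf ((fun L : ℝ → ℝ => ∫ y, y * L y ∂ν) '' likelihoodRatios ν t)

/-- The asymmetric loss derivative whose root in `s` is the largest tilted mean. -/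
def tiltGap (ν : Measure ℝ) (t s : ℝ) : ℝ :=
  ∫ y, (t * max (y - s) 0 - max (s - y) 0) ∂ν

variable {ν : Measure ℝ} [IsProbabilityMeasure ν] {t : ℝ}

lemma integrable_tilt (hi : Integrable (fun y => y) ν) (t s : ℝ) :
    Integrable (fun y => t * max (y - s) 0 - max (s - y) 0) ν :=
  ((hi.sub (integrable_const s)).pos_part.const_mul t).sub
    (((integrable_const s).sub hi).pos_part)

/-- For fixed `y` the integrand is piecewise linear in `s`, with slope `-t` for `s < y` and `-1` for
`s > y`. As `t ≥ 1`, the gap falls at a rate between `1` and `t`: the upper rate gives continuity,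
the lower one a unique root. -/
lemma tiltGap_sub_mem (hi : Integrable (fun y => y) ν) (ht : 1 ≤ t) {s s' : ℝ} (h : s ≤ s') :
    s' - s ≤ tiltGap ν t s - tiltGap ν t s' ∧ tiltGap ν t s - tiltGap ν t s' ≤ t * (s' - s) := by
  unfold tiltGap
  rw [← integral_sub (integrable_tilt hi t s) (integrable_tilt hi t s')]
  have hd := (integrable_tilt hi t s).sub (integrable_tilt hi t s')
  have e : ∀ c : ℝ, c = ∫ _, c ∂ν := fun c => by simp
  constructor
  · rw [e (s' - s)]
    refine integral_mono (integrable_const _) hd fun y => ?_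
    simp only
    rcases max_cases (y - s) 0 with ⟨h1, h1'⟩ | ⟨h1, h1'⟩ <;>
    rcases max_cases (y - s') 0 with ⟨h2, h2'⟩ | ⟨h2, h2'⟩ <;>
    rcases max_cases (s - y) 0 with ⟨h3, h3'⟩ | ⟨h3, h3'⟩ <;>
    rcases max_cases (s' - y) 0 with ⟨h4, h4'⟩ | ⟨h4, h4'⟩ <;>
    rw [h1, h2, h3, h4] <;> nlinarith
  · rw [e (t * (s' - s))]
    refine integral_mono hd (integrable_const _) fun y => ?_
    simp only
    rcases max_cases (y - s) 0 with ⟨h1, h1'⟩ | ⟨h1, h1'⟩ <;>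
    rcases max_cases (y - s') 0 with ⟨h2, h2'⟩ | ⟨h2, h2'⟩ <;>
    rcases max_cases (s - y) 0 with ⟨h3, h3'⟩ | ⟨h3, h3'⟩ <;>
    rcases max_cases (s' - y) 0 with ⟨h4, h4'⟩ | ⟨h4, h4'⟩ <;>
    rw [h1, h2, h3, h4] <;> nlinarith

lemma exists_tiltGap_eq_zero (hi : Integrable (fun y => y) ν) (ht : 1 ≤ t) :
    ∃ s, tiltGap ν t s = 0 := by
  have hlip : LipschitzWith (Real.toNNReal t) (tiltGap ν t) := by
    refine LipschitzWith.of_dist_le_mul fun s s' => ?_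
    rw [Real.coe_toNNReal t (by linarith), Real.dist_eq, Real.dist_eq]
    rcases le_total s s' with h | h
    · have := tiltGap_sub_mem hi ht h
      rw [abs_of_nonneg (by linarith), abs_of_nonpos (by linarith)]
      linarith
    · have := tiltGap_sub_mem hi ht h
      rw [abs_of_nonpos (by linarith), abs_of_nonneg (by linarith)]
      linarith
  -- Falling at rate at least `1`, the gap changes sign within distance `|tiltGap ν t 0|` of the
  -- origin.
  set g := |tiltGap ν t 0|
  have hg : 0 ≤ g := abs_nonneg _
  have h1 := (tiltGap_sub_mem hi ht hg).1
  have h2 := (tiltGap_sub_mem hi ht (neg_nonpos.2 hg)).1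
  have h3 := le_abs_self (tiltGap ν t 0)
  have h4 := neg_abs_le (tiltGap ν t 0)
  obtain ⟨s, -, hs⟩ := intermediate_value_Icc' (show -g ≤ g by linarith) hlip.continuous.continuousOn
    (show (0 : ℝ) ∈ Set.Icc (tiltGap ν t g) (tiltGap ν t (-g)) from
      ⟨by linarith, by linarith⟩)
  exact ⟨s, hs⟩

lemma integrable_of_mem_likelihoodRatios {ν : Measure ℝ} {L : ℝ → ℝ} (hL : L ∈ likelihoodRatios ν t) :
    Integrable L ν := by
  by_contra h
  have := hL.2.2
  rw [integral_undef h] at this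
  exact zero_ne_one this

lemma le_of_mem_likelihoodRatios {L : ℝ → ℝ} (hL : L ∈ likelihoodRatios ν t) (y : ℝ) :
    L y ≤ t := by
  have h := integral_mono (integrable_const (L y))
    ((integrable_of_mem_likelihoodRatios hL).const_mul t) fun y' => (hL.2.1 y y').2
  rw [integral_const_mul, hL.2.2] at h
  simpa using h

lemma integrable_mul_of_mem_likelihoodRatios (hi : Integrable (fun y => y) ν) {L : ℝ → ℝ}
    (hL : L ∈ likelihoodRatios ν t) : Integrable (fun y => y * L y) ν := by
  refine hi.mul_bdd hL.1.aestronglyMeasurable (c := t) (ae_of_all _ fun y => ?_)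
  rw [Real.norm_eq_abs, abs_of_nonneg (hL.2.1 y y).1]
  exact le_of_mem_likelihoodRatios hL y

lemma abs_integral_le_of_mem_likelihoodRatios (hi : Integrable (fun y => y) ν) {L : ℝ → ℝ}
    (hL : L ∈ likelihoodRatios ν t) : |∫ y, y * L y ∂ν| ≤ t * ∫ y, |y| ∂ν := by
  rw [← integral_const_mul]
  refine (abs_integral_le_integral_abs).trans (integral_mono
    (integrable_mul_of_mem_likelihoodRatios hi hL).abs (hi.abs.const_mul t) fun y => ?_)
  simp only
  rw [abs_mul, abs_of_nonneg (hL.2.1 y y).1, mul_comm]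
  exact mul_le_mul_of_nonneg_right (le_of_mem_likelihoodRatios hL y) (abs_nonneg y)

/-- The optimal weight is two-valued: `t` from `s` upwards and `1` below, normalised; its integral
against `y - s` is a multiple of the gap, hence `0`. For any competitor `L` with infimum `c`, the
bounds `c ≤ L ≤ t c` give `(y - s) L(y) ≤ c {t (y - s)₊ - (s - y)₊}` pointwise, so its tilted mean
is at most `s`. -/
lemma isGreatest_of_tiltGap_eq_zero (hi : Integrable (fun y => y) ν) (ht : 1 ≤ t) {s : ℝ}
    (hs : tiltGap ν t s = 0) :
    IsGreatest ((fun L : ℝ → ℝ => ∫ y, y * L y ∂ν) '' likelihoodRatios ν t) s := by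
  have ht0 : 0 < t := by linarith
  constructor
  · let K : ℝ → ℝ := fun y => if s ≤ y then t else 1
    have hKm : Measurable K := Measurable.ite measurableSet_Ici measurable_const measurable_const
    have hK1 : ∀ y, 1 ≤ K y := fun y => by simp only [K]; split_ifs <;> linarith
    have hKt : ∀ y, K y ≤ t := fun y => by simp only [K]; split_ifs <;> linarith
    have hKi : Integrable K ν := by
      refine (integrable_const t).mono' hKm.aestronglyMeasurable (ae_of_all _ fun y => ?_)
      rw [Real.norm_eq_abs, abs_of_nonneg (by linarith [hK1 y])]
      exact hKt y
    have hI : 1 ≤ ∫ y, K y ∂ν := by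
      have := integral_mono (integrable_const (1 : ℝ)) hKi hK1
      simpa using this
    set I := ∫ y, K y ∂ν
    have hI0 : 0 < I := by linarith
    have hmem : (fun y => I⁻¹ * K y) ∈ likelihoodRatios ν t := by
      refine ⟨hKm.const_mul _, fun y y' => ⟨?_, ?_⟩, ?_⟩
      · exact mul_nonneg (inv_nonneg.2 hI0.le) (by linarith [hK1 y])
      · rw [mul_left_comm]
        refine mul_le_mul_of_nonneg_left ?_ (inv_nonneg.2 hI0.le)
        nlinarith [hKt y, hK1 y']
      · rw [integral_const_mul]
        exact inv_mul_cancel₀ hI0.ne'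
    refine ⟨_, hmem, ?_⟩
    have h1 : ∫ y, (y * (I⁻¹ * K y) - s * (I⁻¹ * K y)) ∂ν = I⁻¹ * tiltGap ν t s := by
      unfold tiltGap
      rw [← integral_const_mul]
      refine integral_congr_ae (ae_of_all _ fun y => ?_)
      simp only [K]
      split_ifs with h
      · rw [max_eq_left (by linarith), max_eq_right (by linarith)]; ring
      · rw [max_eq_right (by linarith), max_eq_left (by linarith)]; ring
    rw [integral_sub (integrable_mul_of_mem_likelihoodRatios hi hmem)
      ((integrable_of_mem_likelihoodRatios hmem).const_mul s), integral_const_mul, hmem.2.2, hs] at h1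
    simp only
    linarith
  · rintro _ ⟨L, hL, rfl⟩
    have hbdd : BddBelow (Set.range L) := ⟨0, by rintro _ ⟨y, rfl⟩; exact (hL.2.1 y y).1⟩
    set c := ⨅ y, L y
    have hc : ∀ y, c ≤ L y := fun y => ciInf_le hbdd y
    have hct : ∀ y, L y ≤ t * c := fun y => by
      rw [← div_le_iff₀' ht0]
      refine le_ciInf fun y' => ?_
      rw [div_le_iff₀' ht0]
      exact (hL.2.1 y y').2
    have h1 : ∫ y, (y * L y - s * L y) ∂ν ≤ c * tiltGap ν t s := by
      unfold tiltGap
      rw [← integral_const_mul]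
      refine integral_mono ((integrable_mul_of_mem_likelihoodRatios hi hL).sub
        ((integrable_of_mem_likelihoodRatios hL).const_mul s))
        ((integrable_tilt hi t s).const_mul c) fun y => ?_
      simp only
      rcases le_total s y with h | h
      · rw [max_eq_left (by linarith), max_eq_right (by linarith)]
        nlinarith [hct y]
      · rw [max_eq_right (by linarith), max_eq_left (by linarith)]
        nlinarith [hc y]
    rw [integral_sub (integrable_mul_of_mem_likelihoodRatios hi hL)
      ((integrable_of_mem_likelihoodRatios hL).const_mul s), integral_const_mul, hL.2.2, hs] at h1
    simp only
    linarith

lemma tiltGap_maxTiltedMean (hi : Integrable (fun y => y) ν) (ht : 1 ≤ t) :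
    tiltGap ν t (maxTiltedMean ν t) = 0 := by
  obtain ⟨s, hs⟩ := exists_tiltGap_eq_zero hi ht
  rwa [maxTiltedMean, (isGreatest_of_tiltGap_eq_zero hi ht hs).csSup_eq]

/-- Serves measurability: a superlevel set of a supremum over an uncountable class becomes a
superlevel set of a single integral. -/
lemma lt_maxTiltedMean_iff (hi : Integrable (fun y => y) ν) (ht : 1 ≤ t) {r : ℝ} :
    r < maxTiltedMean ν t ↔ 0 < tiltGap ν t r := by
  have h0 := tiltGap_maxTiltedMean hi ht
  constructor <;> intro h
  · linarith [(tiltGap_sub_mem hi ht h.le).1]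
  · by_contra! hc
    linarith [(tiltGap_sub_mem hi ht hc).1]

lemma abs_maxTiltedMean_le (hi : Integrable (fun y => y) ν) (ht : 1 ≤ t) :
    |maxTiltedMean ν t| ≤ t * ∫ y, |y| ∂ν := by
  obtain ⟨s, hs⟩ := exists_tiltGap_eq_zero hi ht
  have h := isGreatest_of_tiltGap_eq_zero hi ht hs
  rw [maxTiltedMean, h.csSup_eq]
  obtain ⟨L, hL, rfl⟩ := h.1
  exact abs_integral_le_of_mem_likelihoodRatios hi hL

/-- Reflecting `y` to `-y` preserves the class of likelihood ratios, so facts about the smallest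
tilted mean follow from those about the largest. -/
lemma minTiltedMean_eq_neg {ν : Measure ℝ} : minTiltedMean ν t = -maxTiltedMean (ν.map fun y => -y) t := by
  have hm : ∀ f : ℝ → ℝ, ∫ y, f y ∂(ν.map fun y => -y) = ∫ y, f (-y) ∂ν := fun f =>
    integral_map_equiv (MeasurableEquiv.neg ℝ) f
  have hmem : ∀ ν' : Measure ℝ, ∀ L, L ∈ likelihoodRatios (ν'.map fun y => -y) t →
      (fun y => L (-y)) ∈ likelihoodRatios ν' t := by
    rintro ν' L ⟨h1, h2, h3⟩
    refine ⟨h1.comp measurable_neg, fun y y' => h2 (-y) (-y'), ?_⟩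
    rw [← h3]
    exact (integral_map_equiv (MeasurableEquiv.neg ℝ) L).symm
  unfold minTiltedMean maxTiltedMean
  rw [← neg_neg (sInf _), ← Real.sSup_neg]
  congr 2
  ext r
  simp only [Set.mem_neg, Set.mem_image]
  constructor
  · rintro ⟨L, hL, h⟩
    refine ⟨fun y => L (-y), hmem _ _ ?_, ?_⟩
    · rw [Measure.map_map measurable_neg measurable_neg]
      simpa [Function.comp_def] using hL
    · rw [hm]
      simp only [neg_neg, neg_mul, integral_neg, h]
  · rintro ⟨L, hL, h⟩
    refine ⟨fun y => L (-y), hmem _ _ hL, ?_⟩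
    rw [hm] at h
    rw [← h, ← integral_neg]
    simp

lemma integrable_id_map_neg {ν : Measure ℝ} (hi : Integrable (fun y => y) ν) :
    Integrable (fun y => y) (ν.map fun y => -y) :=
  (integrable_map_measure measurable_id.aestronglyMeasurable measurable_neg.aemeasurable).2 hi.neg

lemma isProbabilityMeasure_map_neg : IsProbabilityMeasure (ν.map fun y : ℝ => -y) :=
  Measure.isProbabilityMeasure_map measurable_neg.aemeasurable

lemma abs_minTiltedMean_le (hi : Integrable (fun y => y) ν) (ht : 1 ≤ t) :
    |minTiltedMean ν t| ≤ t * ∫ y, |y| ∂ν := by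
  have := isProbabilityMeasure_map_neg (ν := ν)
  rw [minTiltedMean_eq_neg, abs_neg]
  refine (abs_maxTiltedMean_le (integrable_id_map_neg hi) ht).trans_eq ?_
  rw [integral_map measurable_neg.aemeasurable (by fun_prop)]
  simp

lemma lintegral_pos_eq_of_tiltGap_eq_zero (hi : Integrable (fun y => y) ν) (ht : 0 ≤ t) {s : ℝ}
    (hs : tiltGap ν t s = 0) :
    ENNReal.ofReal t * ∫⁻ y, ENNReal.ofReal (y - s) ∂ν = ∫⁻ y, ENNReal.ofReal (s - y) ∂ν := by
  have h1 : Integrable (fun y => max (y - s) 0) ν := (hi.sub (integrable_const s)).pos_part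
  have h2 : Integrable (fun y => max (s - y) 0) ν := ((integrable_const s).sub hi).pos_part
  have e : ∀ x : ℝ, ENNReal.ofReal x = ENNReal.ofReal (max x 0) := fun x => by
    rw [ENNReal.ofReal_max]; simp
  unfold tiltGap at hs
  rw [integral_sub (h1.const_mul t) h2, integral_const_mul, sub_eq_zero] at hs
  simp_rw [e (_ - _)]
  rw [← ofReal_integral_eq_lintegral_ofReal h1 (ae_of_all _ fun y => le_max_right _ _),
    ← ofReal_integral_eq_lintegral_ofReal h2 (ae_of_all _ fun y => le_max_right _ _),
    ← ENNReal.ofReal_mul ht, hs]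

/-- Balance of the two tails at the largest tilted mean. -/
lemma lintegral_maxTiltedMean (hi : Integrable (fun y => y) ν) (ht : 1 ≤ t) :
    ENNReal.ofReal t * ∫⁻ y, ENNReal.ofReal (y - maxTiltedMean ν t) ∂ν =
      ∫⁻ y, ENNReal.ofReal (maxTiltedMean ν t - y) ∂ν :=
  lintegral_pos_eq_of_tiltGap_eq_zero hi (by linarith) (tiltGap_maxTiltedMean hi ht)

/-- Balance of the two tails at the smallest tilted mean. -/
lemma lintegral_minTiltedMean (hi : Integrable (fun y => y) ν) (ht : 1 ≤ t) :
    ENNReal.ofReal t * ∫⁻ y, ENNReal.ofReal (minTiltedMean ν t - y) ∂ν =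
      ∫⁻ y, ENNReal.ofReal (y - minTiltedMean ν t) ∂ν := by
  have := isProbabilityMeasure_map_neg (ν := ν)
  have h := lintegral_maxTiltedMean (integrable_id_map_neg hi) ht
  rw [lintegral_map (by fun_prop) measurable_neg, lintegral_map (by fun_prop) measurable_neg] at h
  rw [minTiltedMean_eq_neg]
  convert! h using 3
  · ext y; congr 1; ring
  · congr 1; ring

lemma aemeasurable_maxTiltedMean {𝓥 : Type*} [MeasurableSpace 𝓥] (κ : Kernel 𝓥 ℝ)
    [IsMarkovKernel κ] (ht : 1 ≤ t) {μ : Measure 𝓥}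
    (hi : ∀ᵐ v ∂μ, Integrable (fun y => y) (κ v)) :
    AEMeasurable (fun v => maxTiltedMean (κ v) t) μ := by
  classical
  have hI : MeasurableSet {v | Integrable (fun y => y) (κ v)} :=
    ProbabilityTheory.measurableSet_kernel_integrable
      (f := fun _ y => y) measurable_snd.stronglyMeasurable
  have hg : ∀ r, Measurable fun v => tiltGap (κ v) t r := fun r =>
    (StronglyMeasurable.integral_kernel_prod_right' (κ := κ)
      (f := fun z : 𝓥 × ℝ => t * max (z.2 - r) 0 - max (r - z.2) 0)
      (by fun_prop : Measurable _).stronglyMeasurable).measurable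
  -- The root description needs a first moment, so the measurable version is set to `0` on the null
  -- set where that moment fails to exist.
  refine ⟨fun v => if Integrable (fun y => y) (κ v) then maxTiltedMean (κ v) t else 0,
    measurable_of_Ioi fun r => ?_, ?_⟩
  · have : (fun v => if Integrable (fun y => y) (κ v) then maxTiltedMean (κ v) t else 0) ⁻¹'
        Set.Ioi r = {v | Integrable (fun y => y) (κ v)} ∩ {v | 0 < tiltGap (κ v) t r} ∪
          {v | Integrable (fun y => y) (κ v)}ᶜ ∩ {_v | r < 0} := by
      ext v
      by_cases h : Integrable (fun y => y) (κ v)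
      · simp [h, lt_maxTiltedMean_iff h ht]
      · simp [h]
    rw [this]
    exact (hI.inter (measurableSet_lt measurable_const (hg r))).union
      (hI.compl.inter (MeasurableSet.const _))
  · filter_upwards [hi] with v hv
    simp [hv]

lemma aemeasurable_minTiltedMean {𝓥 : Type*} [MeasurableSpace 𝓥] (κ : Kernel 𝓥 ℝ)
    [IsMarkovKernel κ] (ht : 1 ≤ t) {μ : Measure 𝓥}
    (hi : ∀ᵐ v ∂μ, Integrable (fun y => y) (κ v)) :
    AEMeasurable (fun v => minTiltedMean (κ v) t) μ := by
  have hm : Measurable fun y : ℝ => -y := measurable_neg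
  have := Kernel.IsMarkovKernel.map κ hm
  have e : (fun v => minTiltedMean (κ v) t) =
      fun v => -maxTiltedMean ((κ.map fun y => -y) v) t := by
    ext v
    rw [minTiltedMean_eq_neg, Kernel.map_apply _ hm]
  rw [e]
  refine (aemeasurable_maxTiltedMean _ ht ?_).neg
  filter_upwards [hi] with v hv
  rw [Kernel.map_apply _ hm]
  exact integrable_id_map_neg hv

end Extremal

/-! ### Real inequalities equivalent to bounds on the log odds ratio. -/

section LogOdds

lemma absLogOddsRatio_eq {p q : ℝ} (hp : 0 < p) (hp1 : p < 1) (hq : 0 < q) (hq1 : q < 1) :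
    absLogOddsRatio p q =
      ENNReal.ofReal |Real.log (p / (1 - p)) - Real.log (q / (1 - q))| := by
  have h1 : 0 < p / (1 - p) := div_pos hp (by linarith)
  have h2 : 0 < q / (1 - q) := div_pos hq (by linarith)
  rw [absLogOddsRatio, odds, odds, ← ENNReal.ofReal_div_of_pos (by linarith),
    ← ENNReal.ofReal_div_of_pos (by linarith), ← ENNReal.ofReal_div_of_pos h2,
    ENNReal.log_ofReal_of_pos (div_pos h1 h2), EReal.abs_def, Real.log_div h1.ne' h2.ne']

lemma abs_log_odds_le {ε p : ℝ} (hε : 0 < ε) (hp : ε ≤ p) (hp1 : p ≤ 1 - ε) :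
    |Real.log (p / (1 - p))| ≤ -Real.log ε := by
  have h1 : ε ≤ p / (1 - p) := by
    rw [le_div_iff₀ (by linarith)]; nlinarith
  have h2 : p / (1 - p) ≤ ε⁻¹ := by
    rw [div_le_iff₀ (by linarith), inv_mul_eq_div, le_div_iff₀ hε]; nlinarith
  rw [abs_le, neg_neg, ← Real.log_inv]
  exact ⟨Real.log_le_log hε h1, Real.log_le_log (hε.trans_le h1) h2⟩

lemma absLogOddsRatio_le {ε p q : ℝ} (hε : 0 < ε) (hp : ε ≤ p) (hp1 : p ≤ 1 - ε)
    (hq : ε ≤ q) (hq1 : q ≤ 1 - ε) :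
    absLogOddsRatio p q ≤ ENNReal.ofReal (2 * -Real.log ε) := by
  rw [absLogOddsRatio_eq (by linarith) (by linarith) (by linarith) (by linarith)]
  refine ENNReal.ofReal_le_ofReal ((abs_sub _ _).trans ?_)
  linarith [abs_log_odds_le hε hp hp1, abs_log_odds_le hε hq hq1]

/-- A probability `0` or `1` has odds `0` or `∞`, and the conventions `0 / 0 = 0` and `∞ / ∞ = 0`
still make the ratio `0` or `∞`, with infinite absolute logarithm. So a finite odds bound itself
forces nondegenerate propensities given `(X, W)`. -/
lemma mem_Ioo_of_absLogOddsRatio_ne_top {p q : ℝ} (h : absLogOddsRatio p q ≠ ∞) :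
    (0 < p ∧ p < 1) ∧ 0 < q ∧ q < 1 := by
  have h1 : odds p / odds q ≠ 0 := fun hc => h (by rw [absLogOddsRatio, hc]; simp)
  have h2 : odds p / odds q ≠ ∞ := fun hc => h (by rw [absLogOddsRatio, hc]; simp)
  have hq0 : odds q ≠ 0 := fun hc => by
    rw [hc] at h1 h2
    by_cases hp : odds p = 0
    · simp [hp] at h1
    · exact h2 (ENNReal.div_zero hp)
  have hqt : odds q ≠ ∞ := fun hc => h1 (by rw [hc, ENNReal.div_top])
  have hp0 : odds p ≠ 0 := fun hc => h1 (by rw [hc, ENNReal.zero_div])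
  have hpt : odds p ≠ ∞ := fun hc => h2 (by rw [hc, ENNReal.top_div_of_ne_top hqt])
  have key : ∀ r : ℝ, odds r ≠ 0 → odds r ≠ ∞ → 0 < r ∧ r < 1 := by
    intro r h0 ht
    have hr : 0 < r := by
      by_contra! hc
      exact h0 (by rw [odds, ENNReal.ofReal_of_nonpos hc, ENNReal.zero_div])
    refine ⟨hr, ?_⟩
    by_contra! hc
    refine ht ?_
    rw [odds, ENNReal.ofReal_of_nonpos (by linarith : 1 - r ≤ 0)]
    exact ENNReal.div_zero (ENNReal.ofReal_pos.2 hr).ne'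
  exact ⟨key p hp0 hpt, key q hq0 hqt⟩

/-- The division-free form can be integrated over both arguments; its two halves serve the two arms.
-/
lemma cross_le_of_absLogOddsRatio_le {p q b : ℝ} (hb : 0 ≤ b)
    (h : absLogOddsRatio p q ≤ ENNReal.ofReal b) :
    p * (1 - q) ≤ Real.exp b * (q * (1 - p)) ∧ q * (1 - p) ≤ Real.exp b * (p * (1 - q)) := by
  obtain ⟨⟨hp, hp1⟩, hq, hq1⟩ :=
    mem_Ioo_of_absLogOddsRatio_ne_top (ne_top_of_le_ne_top ENNReal.ofReal_ne_top h)
  have key : ∀ r s : ℝ, 0 < r → r < 1 → 0 < s → s < 1 →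
      Real.log (r / (1 - r)) - Real.log (s / (1 - s)) ≤ b →
      r * (1 - s) ≤ Real.exp b * (s * (1 - r)) := by
    intro r s hr hr1 hs hs1 hrs
    have h1 : 0 < r / (1 - r) := div_pos hr (by linarith)
    have h2 : 0 < s / (1 - s) := div_pos hs (by linarith)
    have h3 : r / (1 - r) ≤ Real.exp b * (s / (1 - s)) := by
      rw [← Real.log_le_log_iff h1 (by positivity), Real.log_mul (by positivity) h2.ne',
        Real.log_exp]
      linarith
    rw [← mul_div_assoc, div_le_div_iff₀ (by linarith) (by linarith)] at h3
    linarith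
  rw [absLogOddsRatio_eq hp hp1 hq hq1, ENNReal.ofReal_le_ofReal_iff hb, abs_le] at h
  exact ⟨key p q hp hp1 hq hq1 h.2, key q p hq hq1 hp hp1 (by linarith [h.1])⟩

end LogOdds

/-! ### Finiteness of the measured odds confounding. -/

section MeasuredConfounding

variable {Ω 𝓥 𝓤 : Type*} [MeasurableSpace Ω] [MeasurableSpace 𝓥] [MeasurableSpace 𝓤]
  {P : Measure Ω} [IsProbabilityMeasure P] {A : Ω → Fin 2} {V : Ω → 𝓥}

/-- Positivity is inherited by coarser covariates. -/
lemma Positivity.comp (h : Positivity P A V) (hA : Measurable A) (hV : Measurable V) {g : 𝓥 → 𝓤}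
    (hg : Measurable g) : Positivity P A (fun ω => g (V ω)) := by
  obtain ⟨ε, hε, h⟩ := h.exists_le_propensity hV
  refine ⟨ε, hε, ?_⟩
  have hgV : Measurable fun ω => g (V ω) := hg.comp hV
  have key : ∀ a, ∀ᵐ ω ∂P, ε ≤ propensity P A (fun ω => g (V ω)) a (g (V ω)) := by
    intro a
    have := Measure.isProbabilityMeasure_map (μ := P) hgV.aemeasurable
    -- Over each event `g(V) ∈ s` the coarse and the fine propensity have the same integral, namely
    -- the probability of `A = a` there, and the fine one is at least `ε`.
    have h1 : (fun _ => ENNReal.ofReal ε) ≤ᵐ[P.map fun ω => g (V ω)]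
        fun u => condDistrib A (fun ω => g (V ω)) P u {a} := by
      refine ae_le_of_forall_setLIntegral_le_of_sigmaFinite measurable_const fun s hs _ => ?_
      rw [setLIntegral_map hs measurable_const hgV,
        setLIntegral_map hs (Kernel.measurable_coe _ (measurableSet_singleton a)) hgV,
        setLIntegral_preimage_condDistrib hgV hA.aemeasurable (measurableSet_singleton a) hs]
      have e : (fun ω => g (V ω)) ⁻¹' s = V ⁻¹' (g ⁻¹' s) := rfl
      rw [e, ← setLIntegral_preimage_condDistrib hV hA.aemeasurable (measurableSet_singleton a)
        (hg hs)]
      refine setLIntegral_mono_ae' (hV (hg hs)) ?_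
      filter_upwards [ae_of_ae_map hV.aemeasurable h] with ω hω _
      rw [← ofReal_propensity]
      exact ENNReal.ofReal_le_ofReal (hω a)
    filter_upwards [ae_of_ae_map hgV.aemeasurable h1] with ω hω
    rw [← ofReal_propensity] at hω
    exact (ENNReal.ofReal_le_ofReal_iff (propensity_nonneg _ _)).1 hω
  filter_upwards [key 0, key 1] with ω h0 h1
  have h2 := propensity_add (P := P) (A := A) (V := fun ω => g (V ω)) 1 (g (V ω))
  simp at h2
  exact ⟨h1, by linarith⟩

variable {𝓡 : Type*} [MeasurableSpace 𝓡] [StandardBorelSpace 𝓡] [Nonempty 𝓡] {R : Ω → 𝓡}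

/-- Positivity keeps each log odds within `-log ε` of zero. It is an almost sure statement about
`(V, R)`, and passes to both draws `r, r'` because each has the conditional law of `R` given `V`. -/
lemma oddsConfounding_lt_top (hV : Measurable V) (hR : Measurable R)
    (h : Positivity P A fun ω => (V ω, R ω)) : oddsConfounding P A V R < ∞ := by
  obtain ⟨ε, hε, h⟩ := h.exists_le_propensity (by fun_prop)
  refine lt_of_le_of_lt (essSup_le_of_ae_le (ENNReal.ofReal (2 * -Real.log ε)) ?_)
    ENNReal.ofReal_lt_top
  set π := propensity P A (fun ω => (V ω, R ω)) 1
  have hπ : Measurable π := measurable_propensity 1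
  have h' : ∀ᵐ z ∂(P.map V) ⊗ₘ condDistrib R V P, ε ≤ π z ∧ π z ≤ 1 - ε := by
    rw [compProd_map_condDistrib hR.aemeasurable]
    filter_upwards [h] with z hz
    have h2 := propensity_add (P := P) (A := A) (V := fun ω => (V ω, R ω)) 1 z
    have h0 := hz 0
    simp at h2
    exact ⟨hz 1, by linarith⟩
  have m1 : Measurable fun z : 𝓥 × 𝓡 × 𝓡 => π (z.1, z.2.1) := by fun_prop
  have m2 : Measurable fun z : 𝓥 × 𝓡 × 𝓡 => π (z.1, z.2.2) := by fun_prop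
  have h'' : ∀ᵐ z ∂(P.map V) ⊗ₘ (condDistrib R V P ×ₖ condDistrib R V P),
      (ε ≤ π (z.1, z.2.1) ∧ π (z.1, z.2.1) ≤ 1 - ε) ∧
        (ε ≤ π (z.1, z.2.2) ∧ π (z.1, z.2.2) ≤ 1 - ε) := by
    refine Measure.ae_compProd_of_ae_ae ?_ ?_
    · exact ((measurableSet_le measurable_const m1).inter
        (measurableSet_le m1 measurable_const)).inter
        ((measurableSet_le measurable_const m2).inter (measurableSet_le m2 measurable_const))
    · filter_upwards [Measure.ae_ae_of_ae_compProd h'] with v hv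
      rw [Kernel.prod_apply]
      filter_upwards [Measure.quasiMeasurePreserving_fst.ae hv,
        Measure.quasiMeasurePreserving_snd.ae hv] with z h1 h2
      exact ⟨h1, h2⟩
  filter_upwards [h''] with z hz
  exact absLogOddsRatio_le hε hz.1.1 hz.1.2 hz.2.1 hz.2.2

lemma measuredOddsConfounding_lt_top {d : ℕ} {X : Ω → Fin d → ℝ} (hX : Measurable X)
    (hA : Measurable A) (h : Positivity P A X) : measuredOddsConfounding P X A < ∞ := by
  rw [measuredOddsConfounding]
  rcases isEmpty_or_nonempty (Fin d) with hd | hd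
  · simp
  obtain ⟨j, hj⟩ := exists_eq_ciSup_of_finite
    (f := fun j : Fin d => oddsConfounding P A (drop X {j}) (fun ω => X ω j))
  rw [← hj]
  refine oddsConfounding_lt_top (by unfold drop; fun_prop) (by fun_prop) ?_
  -- The pair `(X_{-j}, X_j)` is a measurable function of `X`.
  exact h.comp hA hX (g := fun x => (fun i : {i : Fin d // i ∉ ({j} : Finset (Fin d))} => x i, x j))
    (by fun_prop)

end MeasuredConfounding

/-! ### Transfer of a balance between two weights with bounded cross ratio. -/

section CrossRatio

variable {𝓦 : Type*} [MeasurableSpace 𝓦] {Q : Measure 𝓦} [IsProbabilityMeasure Q]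
  {p q f g : 𝓦 → ℝ≥0∞} {t : ℝ≥0∞}

/-- Each product of integrals is one integral over two independent copies, where the cross
inequality is multiplied by `f(w) g(w')`. -/
lemma lintegral_mul_le_of_cross_le (hp : Measurable p) (hq : Measurable q) (hf : Measurable f)
    (hg : Measurable g) (hpq : ∀ᵐ z ∂Q.prod Q, q z.1 * p z.2 ≤ t * (p z.1 * q z.2)) :
    (∫⁻ w, q w * f w ∂Q) * ∫⁻ w, p w * g w ∂Q ≤
      t * ((∫⁻ w, p w * f w ∂Q) * ∫⁻ w, q w * g w ∂Q) := by
  rw [← lintegral_prod_mul (by fun_prop) (by fun_prop),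
    ← lintegral_prod_mul (by fun_prop) (by fun_prop), ← lintegral_const_mul _ (by fun_prop)]
  refine lintegral_mono_ae ?_
  filter_upwards [hpq] with z hz
  calc q z.1 * f z.1 * (p z.2 * g z.2) = q z.1 * p z.2 * (f z.1 * g z.2) := by ring
    _ ≤ t * (p z.1 * q z.2) * (f z.1 * g z.2) := by gcongr
    _ = _ := by ring

/-- The balance turns `t ∫ p f` into `∫ p g`, which is then cancelled. If `∫ p g = 0`, nothing can
be cancelled, but then `p f = 0` almost everywhere, so `f = 0` since `p` does not vanish. -/
lemma lintegral_le_of_cross_le (hp : Measurable p) (hq : Measurable q) (hf : Measurable f)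
    (hg : Measurable g) (hpq : ∀ᵐ z ∂Q.prod Q, q z.1 * p z.2 ≤ t * (p z.1 * q z.2))
    (hp0 : ∀ᵐ w ∂Q, p w ≠ 0) (ht : t ≠ 0)
    (h : t * ∫⁻ w, p w * f w ∂Q = ∫⁻ w, p w * g w ∂Q) (htop : ∫⁻ w, p w * g w ∂Q ≠ ∞) :
    ∫⁻ w, q w * f w ∂Q ≤ ∫⁻ w, q w * g w ∂Q := by
  by_cases h0 : ∫⁻ w, p w * g w ∂Q = 0
  · have h1 : ∫⁻ w, p w * f w ∂Q = 0 := by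
      rw [h0] at h
      exact (mul_eq_zero.1 h).resolve_left ht
    rw [lintegral_eq_zero_iff (by fun_prop)] at h1
    have h2 : ∫⁻ w, q w * f w ∂Q = 0 := by
      rw [lintegral_eq_zero_iff (by fun_prop)]
      filter_upwards [h1, hp0] with w hw hw0
      simp only [Pi.zero_apply, mul_eq_zero, hw0, false_or] at hw ⊢
      exact Or.inr hw
    rw [h2]
    exact zero_le
  · have := lintegral_mul_le_of_cross_le hp hq hf hg hpq
    rw [← mul_assoc, h, mul_comm] at this
    exact (ENNReal.mul_le_mul_iff_right h0 htop).1 this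

end CrossRatio

/-! ### From the observed to the unobserved arm through the unmeasured confounder. -/

section Unmeasured

variable {Ω 𝓦 : Type*} [MeasurableSpace Ω] [MeasurableSpace 𝓦]
  {P : Measure Ω} [IsProbabilityMeasure P] {d : ℕ} {X : Ω → Fin d → ℝ} {A : Ω → Fin 2}
  {Y : Ω → ℝ} {Ypot : Fin 2 → Ω → ℝ} {W : Ω → 𝓦}

/-- The coordinate `Y^a` of `(Y^0, Y^1)`. -/
def pairCoord (a : Fin 2) (y : ℝ × ℝ) : ℝ := if a = 0 then y.1 else y.2

lemma measurable_pairCoord (a : Fin 2) : Measurable (pairCoord a) := by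
  unfold pairCoord
  fin_cases a
  · simpa using measurable_fst
  · simpa using measurable_snd

lemma pairCoord_apply {Ω : Type*} {Ypot : Fin 2 → Ω → ℝ} (a : Fin 2) (ω : Ω) : pairCoord a (Ypot 0 ω, Ypot 1 ω) = Ypot a ω := by
  fin_cases a <;> simp [pairCoord]

/-- `E{f(X, Y^a) | X, W}`. -/
def potMean (P : Measure Ω) [IsProbabilityMeasure P] (X : Ω → Fin d → ℝ) (Ypot : Fin 2 → Ω → ℝ)
    (W : Ω → 𝓦) (a : Fin 2) (f : (Fin d → ℝ) × ℝ → ℝ≥0∞) (z : (Fin d → ℝ) × 𝓦) : ℝ≥0∞ :=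
  ∫⁻ y, f (z.1, pairCoord a y)
    ∂condDistrib (fun ω => (Ypot 0 ω, Ypot 1 ω)) (fun ω => (X ω, W ω)) P z

lemma measurable_potMean (a : Fin 2) {f : (Fin d → ℝ) × ℝ → ℝ≥0∞} (hf : Measurable f) :
    Measurable (potMean P X Ypot W a f) := by
  have := measurable_pairCoord a
  exact Measurable.lintegral_kernel_prod_right'
    (f := fun z : ((Fin d → ℝ) × 𝓦) × ℝ × ℝ => f (z.1.1, pairCoord a z.2)) (by fun_prop)

variable [StandardBorelSpace 𝓦] [Nonempty 𝓦]

/-- Given `(X, W)`, independence splits the integral into propensity times `potMean`. The second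
factor does not depend on `b`, which is what links the two arms. -/
lemma IsUnmeasuredConfounder.setLIntegral (h : IsUnmeasuredConfounder P X A Ypot W)
    (hX : Measurable X) (hA : Measurable A) (hYpot : ∀ a, Measurable (Ypot a)) (hW : Measurable W)
    (a b : Fin 2) {f : (Fin d → ℝ) × ℝ → ℝ≥0∞} (hf : Measurable f) :
    ∫⁻ ω in A ⁻¹' {b}, f (X ω, Ypot a ω) ∂P =
      ∫⁻ x, ∫⁻ w, condDistrib A (fun ω => (X ω, W ω)) P (x, w) {b} * potMean P X Ypot W a f (x, w)
        ∂condDistrib W X P x ∂P.map X := by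
  have hc := measurable_pairCoord a
  have h1 : Measurable (({b} : Set (Fin 2)).indicator (1 : Fin 2 → ℝ≥0∞)) := measurable_of_finite _
  let g : ((Fin d → ℝ) × 𝓦) × (ℝ × ℝ) × Fin 2 → ℝ≥0∞ :=
    fun z => f (z.1.1, pairCoord a z.2.1) * ({b} : Set (Fin 2)).indicator 1 z.2.2
  have hg : Measurable g := by fun_prop
  have hk : Measurable fun z => condDistrib A (fun ω => (X ω, W ω)) P z {b} :=
    Kernel.measurable_coe _ (measurableSet_singleton b)
  have hpm := measurable_potMean (P := P) (X := X) (Ypot := Ypot) (W := W) a hf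
  have := hYpot 0
  have := hYpot 1
  calc ∫⁻ ω in A ⁻¹' {b}, f (X ω, Ypot a ω) ∂P
      = ∫⁻ ω, g ((X ω, W ω), (Ypot 0 ω, Ypot 1 ω), A ω) ∂P := by
        rw [← lintegral_indicator (hA (measurableSet_singleton b))]
        refine lintegral_congr fun ω => ?_
        by_cases hb : A ω = b <;> simp [g, hb, pairCoord_apply]
    _ = ∫⁻ z, g z ∂P.map (fun ω => ((X ω, W ω), ((Ypot 0 ω, Ypot 1 ω), A ω))) := by
        rw [lintegral_map hg (by fun_prop)]
    _ = ∫⁻ z, condDistrib A (fun ω => (X ω, W ω)) P z {b} * potMean P X Ypot W a f z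
          ∂P.map (fun ω => (X ω, W ω)) := by
        rw [h, Measure.lintegral_compProd hg]
        refine lintegral_congr fun z => ?_
        rw [Kernel.prod_apply]
        simp only [g]
        rw [lintegral_prod_mul (f := fun y => f (z.1, pairCoord a y)) (by fun_prop) (by fun_prop),
          lintegral_indicator_one (measurableSet_singleton b), mul_comm]
        rfl
    _ = _ := by
        rw [← compProd_map_condDistrib hW.aemeasurable, Measure.lintegral_compProd
          (by fun_prop : Measurable fun z => condDistrib A (fun ω => (X ω, W ω)) P z {b} *
            potMean P X Ypot W a f z)]

/-- If the odds ratios of `π(X, W)` have spread at most `t` given `X`, then a balance with factor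
`t` between two functions of `(X, Y)` on the arm `a` becomes an inequality for `Y^a` on the other
arm. -/
lemma IsUnmeasuredConfounder.setLIntegral_le (h : IsUnmeasuredConfounder P X A Ypot W)
    (hX : Measurable X) (hA : Measurable A) (hY : Measurable Y)
    (hYpot : ∀ a, Measurable (Ypot a)) (hW : Measurable W)
    (hcons : Consistency P A Y Ypot) {b : ℝ} (hb : 0 ≤ b)
    (hodds : oddsConfounding P A X W ≤ ENNReal.ofReal b) (a : Fin 2)
    {f g : (Fin d → ℝ) × ℝ → ℝ≥0∞} (hf : Measurable f) (hg : Measurable g)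
    (hfg : ∀ᵐ x ∂P.map X, ENNReal.ofReal (Real.exp b) * ∫⁻ y, f (x, y) ∂condLaw P A X Y a x =
      ∫⁻ y, g (x, y) ∂condLaw P A X Y a x)
    (htop : ∀ᵐ x ∂P.map X, ∫⁻ y, g (x, y) ∂condLaw P A X Y a x ≠ ∞) :
    ∫⁻ ω in A ⁻¹' {1 - a}, f (X ω, Ypot a ω) ∂P ≤
      ∫⁻ ω in A ⁻¹' {1 - a}, g (X ω, Ypot a ω) ∂P := by
  set p : Fin 2 → (Fin d → ℝ) × 𝓦 → ℝ≥0∞ :=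
    fun c z => condDistrib A (fun ω => (X ω, W ω)) P z {c} with hp_def
  have hp : ∀ c, Measurable (p c) := fun c => Kernel.measurable_coe _ (measurableSet_singleton c)
  -- Both sides are the conditional integral of `k(X, Y)` on the arm `a` given `X`: consistency puts
  -- `Y^a` for `Y` there, and uniqueness gives almost sure equality.
  have hlink : ∀ {k : (Fin d → ℝ) × ℝ → ℝ≥0∞}, Measurable k → ∀ᵐ x ∂P.map X,
      condDistrib A X P x {a} * ∫⁻ y, k (x, y) ∂condLaw P A X Y a x =
        ∫⁻ w, p a (x, w) * potMean P X Ypot W a k (x, w) ∂condDistrib W X P x := by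
    intro k hk
    have hpm := measurable_potMean (P := P) (X := X) (Ypot := Ypot) (W := W) a hk
    refine ae_eq_of_setLIntegral_arm hA hX hY a hk
      (g := fun x => ∫⁻ w, p a (x, w) * potMean P X Ypot W a k (x, w) ∂condDistrib W X P x)
      ((hp a).mul hpm).lintegral_kernel_prod_right' fun s hs => ?_
    have h1 : Measurable (s.indicator (1 : (Fin d → ℝ) → ℝ≥0∞)) := measurable_one.indicator hs
    trans ∫⁻ ω in A ⁻¹' {a}, s.indicator 1 (X ω) * k (X ω, Ypot a ω) ∂P
    · refine setLIntegral_congr_fun_ae (hA (measurableSet_singleton a)) ?_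
      filter_upwards [hcons] with ω hω hωa
      rw [hω a hωa]
    · rw [h.setLIntegral hX hA hYpot hW a a (f := fun z => s.indicator 1 z.1 * k z) (by fun_prop),
        ← lintegral_indicator hs]
      refine lintegral_congr fun x => ?_
      by_cases hx : x ∈ s <;> simp [potMean, hx, p]
  have hcross : ∀ᵐ x ∂P.map X, ∀ᵐ z ∂(condDistrib W X P x).prod (condDistrib W X P x),
      p (1 - a) (x, z.1) * p a (x, z.2) ≤
        ENNReal.ofReal (Real.exp b) * (p a (x, z.1) * p (1 - a) (x, z.2)) ∧ p a (x, z.1) ≠ 0 := by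
    have h1 := (ENNReal.ae_le_essSup (μ := (P.map X) ⊗ₘ (condDistrib W X P ×ₖ condDistrib W X P))
      (fun z : (Fin d → ℝ) × 𝓦 × 𝓦 =>
      absLogOddsRatio (propensity P A (fun ω => (X ω, W ω)) 1 (z.1, z.2.1))
        (propensity P A (fun ω => (X ω, W ω)) 1 (z.1, z.2.2))))
    have h2 := Measure.ae_ae_of_ae_compProd h1
    filter_upwards [h2] with x hx
    rw [Kernel.prod_apply] at hx
    filter_upwards [hx] with z hz
    have hz' := hz.trans hodds
    obtain ⟨⟨h3, h3'⟩, -⟩ :=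
      mem_Ioo_of_absLogOddsRatio_ne_top (ne_top_of_le_ne_top ENNReal.ofReal_ne_top hz')
    obtain ⟨h4, h5⟩ := cross_le_of_absLogOddsRatio_le hb hz'
    have e1 := propensity_add (P := P) (A := A) (V := fun ω => (X ω, W ω)) 1 (x, z.1)
    have e2 := propensity_add (P := P) (A := A) (V := fun ω => (X ω, W ω)) 1 (x, z.2)
    rw [sub_self] at e1 e2
    simp only [hp_def, ← ofReal_propensity]
    rw [← ENNReal.ofReal_mul (propensity_nonneg _ _), ← ENNReal.ofReal_mul (propensity_nonneg _ _),
      ← ENNReal.ofReal_mul (Real.exp_pos b).le, Ne, ENNReal.ofReal_eq_zero, not_le]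
    refine ⟨ENNReal.ofReal_le_ofReal ?_, ?_⟩
    · fin_cases a
      · simp only [Fin.zero_eta, sub_zero]
        rw [eq_sub_of_add_eq' e1, eq_sub_of_add_eq' e2]
        linarith
      · simp only [Fin.mk_one, sub_self]
        rw [eq_sub_of_add_eq' e1, eq_sub_of_add_eq' e2]
        linarith
    · fin_cases a
      · simp only [Fin.zero_eta]
        linarith
      · exact h3
  rw [h.setLIntegral hX hA hYpot hW a (1 - a) hf, h.setLIntegral hX hA hYpot hW a (1 - a) hg]
  refine lintegral_mono_ae ?_
  filter_upwards [hlink hf, hlink hg, hcross, hfg, htop] with x hxf hxg hxc hxfg hxt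
  have hs : Measurable fun w : 𝓦 => (x, w) := measurable_prodMk_left
  refine lintegral_le_of_cross_le (p := fun w => p a (x, w)) ((hp a).comp hs) ((hp (1 - a)).comp hs)
    ((measurable_potMean a hf).comp hs) ((measurable_potMean a hg).comp hs)
    (hxc.mono fun z hz => hz.1) ?_ (ENNReal.ofReal_pos.2 (Real.exp_pos b)).ne' ?_ ?_
  -- The nonvanishing is known for pairs `(w, w')` but involves `w` only; for almost every `w` some
  -- `w'` exists, as the conditional law has mass `1`.
  · have h6 : ∀ᵐ z ∂(condDistrib W X P x).prod (condDistrib W X P x), p a (x, z.1) ≠ 0 :=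
      hxc.mono fun z hz => hz.2
    exact (Measure.ae_ae_of_ae_prod h6).mono fun w hw => hw.exists.choose_spec
  · simp only [← hxf, ← hxg, ← hxfg]
    ring
  · rw [← hxg]
    exact ENNReal.mul_ne_top (measure_ne_top _ _) hxt

end Unmeasured

/-! ### Integrability of the imputed bounds, and the effect bounds of the odds ratio model. -/

section Theta

variable {Ω : Type*} [MeasurableSpace Ω] {P : Measure Ω} [IsProbabilityMeasure P] {d : ℕ}
  {X : Ω → Fin d → ℝ} {A : Ω → Fin 2} {Y : Ω → ℝ} {Ypot : Fin 2 → Ω → ℝ} {t : ℝ}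

lemma Consistency.integrable {P : Measure Ω} (hcons : Consistency P A Y Ypot) (hY : Measurable Y)
    (hint : ∀ a, Integrable (Ypot a) P) : Integrable Y P := by
  refine ((hint 0).abs.add (hint 1).abs).mono' hY.aestronglyMeasurable ?_
  filter_upwards [hcons] with ω hω
  rw [Real.norm_eq_abs, hω (A ω) rfl]
  simp only [Pi.add_apply]
  rcases Fin.eq_zero_or_eq_succ (A ω) with h | ⟨j, h⟩
  · rw [h]; exact le_add_of_nonneg_right (abs_nonneg _)
  · rw [h, Subsingleton.elim j 0]; exact le_add_of_nonneg_left (abs_nonneg _)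

lemma Positivity.ae_integrable_condLaw (hpos : Positivity P A X) (hA : Measurable A)
    (hX : Measurable X) (hY : Measurable Y) (hi : Integrable Y P) (a : Fin 2) :
    ∀ᵐ x ∂P.map X, Integrable (fun y => y) (condLaw P A X Y a x) :=
  CalibratedSensitivity.ae_integrable_condLaw hA hX hY a hi.restrict (hpos.ne_zero hX a)

lemma aemeasurable_thetaPlus (ht : 1 ≤ t) (a : Fin 2)
    (hi : ∀ᵐ x ∂P.map X, Integrable (fun y => y) (condLaw P A X Y a x)) :
    AEMeasurable (thetaPlus P X A Y a t) (P.map X) :=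
  aemeasurable_maxTiltedMean (armKernel P A X Y a) ht hi

lemma aemeasurable_thetaMinus (ht : 1 ≤ t) (a : Fin 2)
    (hi : ∀ᵐ x ∂P.map X, Integrable (fun y => y) (condLaw P A X Y a x)) :
    AEMeasurable (thetaMinus P X A Y a t) (P.map X) :=
  aemeasurable_minTiltedMean (armKernel P A X Y a) ht hi

lemma Positivity.integrable_thetaPlus (hpos : Positivity P A X) (hA : Measurable A)
    (hX : Measurable X) (hY : Measurable Y) (hi : Integrable Y P) (ht : 1 ≤ t) (a : Fin 2) :
    Integrable (fun ω => thetaPlus P X A Y a t (X ω)) P := by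
  have h := hpos.ae_integrable_condLaw hA hX hY hi a
  refine ((hpos.integrable_condLaw_abs hA hX hY a hi.restrict).const_mul t).mono'
    ((aemeasurable_thetaPlus ht a h).comp_measurable hX).aestronglyMeasurable ?_
  filter_upwards [ae_of_ae_map hX.aemeasurable h] with ω hω
  exact abs_maxTiltedMean_le hω ht

lemma Positivity.integrable_thetaMinus (hpos : Positivity P A X) (hA : Measurable A)
    (hX : Measurable X) (hY : Measurable Y) (hi : Integrable Y P) (ht : 1 ≤ t) (a : Fin 2) :
    Integrable (fun ω => thetaMinus P X A Y a t (X ω)) P := by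
  have h := hpos.ae_integrable_condLaw hA hX hY hi a
  refine ((hpos.integrable_condLaw_abs hA hX hY a hi.restrict).const_mul t).mono'
    ((aemeasurable_thetaMinus ht a h).comp_measurable hX).aestronglyMeasurable ?_
  filter_upwards [ae_of_ae_map hX.aemeasurable h] with ω hω
  exact abs_minTiltedMean_le hω ht

lemma expo_mul_eq_indicator {Ω : Type*} (A : Ω → Fin 2) (f : Ω → ℝ) :
    (fun ω => expo A ω * f ω) = (A ⁻¹' {1}).indicator f := by
  ext ω
  rcases Fin.eq_zero_or_eq_succ (A ω) with h | ⟨j, h⟩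
  · simp [expo, h]
  · rw [Subsingleton.elim j 0] at h
    simp [expo, h]

lemma one_sub_expo_mul_eq_indicator {Ω : Type*} (A : Ω → Fin 2) (f : Ω → ℝ) :
    (fun ω => (1 - expo A ω) * f ω) = (A ⁻¹' {0}).indicator f := by
  ext ω
  rcases Fin.eq_zero_or_eq_succ (A ω) with h | ⟨j, h⟩
  · simp [expo, h]
  · rw [Subsingleton.elim j 0] at h
    simp [expo, h]

lemma integrable_expo_mul {P : Measure Ω} (hA : Measurable A) {f : Ω → ℝ} (hf : Integrable f P) :
    Integrable (fun ω => expo A ω * f ω) P := by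
  rw [expo_mul_eq_indicator]
  exact hf.indicator (hA (measurableSet_singleton 1))

lemma integrable_one_sub_expo_mul {P : Measure Ω} (hA : Measurable A) {f : Ω → ℝ} (hf : Integrable f P) :
    Integrable (fun ω => (1 - expo A ω) * f ω) P := by
  rw [one_sub_expo_mul_eq_indicator]
  exact hf.indicator (hA (measurableSet_singleton 0))

lemma Positivity.integrable_oddsLowerIntegrand (hpos : Positivity P A X) (hA : Measurable A)
    (hX : Measurable X) (hY : Measurable Y) (hi : Integrable Y P) (ht : 1 ≤ t) :
    Integrable (oddsLowerIntegrand P X A Y t) P :=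
  ((integrable_expo_mul hA hi).add (integrable_one_sub_expo_mul hA
    (hpos.integrable_thetaMinus hA hX hY hi ht 1))).sub
    ((integrable_one_sub_expo_mul hA hi).add (integrable_expo_mul hA
    (hpos.integrable_thetaPlus hA hX hY hi ht 0)))

lemma Positivity.integrable_oddsUpperIntegrand (hpos : Positivity P A X) (hA : Measurable A)
    (hX : Measurable X) (hY : Measurable Y) (hi : Integrable Y P) (ht : 1 ≤ t) :
    Integrable (oddsUpperIntegrand P X A Y t) P :=
  ((integrable_expo_mul hA hi).add (integrable_one_sub_expo_mul hA
    (hpos.integrable_thetaPlus hA hX hY hi ht 1))).sub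
    ((integrable_one_sub_expo_mul hA hi).add (integrable_expo_mul hA
    (hpos.integrable_thetaMinus hA hX hY hi ht 0)))

/-- The difference of the effect and an imputed contrast comes from the unobserved arms. -/
lemma Consistency.ate_sub_integral {P : Measure Ω} (hcons : Consistency P A Y Ypot) (hA : Measurable A)
    (hint : ∀ a, Integrable (Ypot a) P) {s₀ s₁ : Ω → ℝ} (hs₀ : Integrable s₀ P)
    (hs₁ : Integrable s₁ P) {k : Ω → ℝ} (hk : Integrable k P)
    (hks : ∀ ω, k ω = expo A ω * Y ω + (1 - expo A ω) * s₁ ω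
      - ((1 - expo A ω) * Y ω + expo A ω * s₀ ω)) :
    ate P Ypot - ∫ ω, k ω ∂P =
      ∫ ω in A ⁻¹' {0}, (Ypot 1 ω - s₁ ω) ∂P - ∫ ω in A ⁻¹' {1}, (Ypot 0 ω - s₀ ω) ∂P := by
  have h0 : Integrable (fun ω => Ypot 1 ω - s₁ ω) P := (hint 1).sub hs₁
  have h1 : Integrable (fun ω => Ypot 0 ω - s₀ ω) P := (hint 0).sub hs₀
  rw [ate, ← integral_sub (f := fun ω => Ypot 1 ω - Ypot 0 ω) ((hint 1).sub (hint 0)) hk,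
    ← integral_indicator (hA (measurableSet_singleton 0)),
    ← integral_indicator (hA (measurableSet_singleton 1)),
    ← one_sub_expo_mul_eq_indicator, ← expo_mul_eq_indicator,
    ← integral_sub (integrable_one_sub_expo_mul hA h0) (integrable_expo_mul hA h1)]
  refine integral_congr_ae ?_
  filter_upwards [hcons] with ω hω
  simp only [hks, expo]
  rcases Fin.eq_zero_or_eq_succ (A ω) with h | ⟨j, h⟩
  · rw [hω 0 h, h]; simp
  · rw [Subsingleton.elim j 0] at h
    rw [hω 1 h, h]; simp

lemma integral_sub_nonpos_of_lintegral_le {μ : Measure Ω} {T s : Ω → ℝ} (hT : Integrable T μ)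
    (hs : Integrable s μ)
    (h : ∫⁻ ω, ENNReal.ofReal (T ω - s ω) ∂μ ≤ ∫⁻ ω, ENNReal.ofReal (s ω - T ω) ∂μ) :
    ∫ ω, (T ω - s ω) ∂μ ≤ 0 := by
  have hTs : Integrable (fun ω => T ω - s ω) μ := hT.sub hs
  have hsT : Integrable (fun ω => s ω - T ω) μ := hs.sub hT
  rw [integral_eq_lintegral_pos_part_sub_lintegral_neg_part hTs, sub_nonpos]
  simp only [neg_sub]
  exact ENNReal.toReal_mono hsT.lintegral_lt_top.ne h

variable {𝓦 : Type*} [MeasurableSpace 𝓦] [StandardBorelSpace 𝓦] [Nonempty 𝓦] {W : Ω → 𝓦}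

lemma lintegral_ofReal_sub_ne_top {ν : Measure ℝ} [IsProbabilityMeasure ν]
    (hi : Integrable (fun y => y) ν) (s : ℝ) :
    ∫⁻ y, ENNReal.ofReal (y - s) ∂ν ≠ ∞ ∧ ∫⁻ y, ENNReal.ofReal (s - y) ∂ν ≠ ∞ :=
  ⟨(hi.sub (integrable_const s)).lintegral_lt_top.ne,
    ((integrable_const s).sub hi).lintegral_lt_top.ne⟩

/-- Under the odds ratio model, imputing `θ^+` overstates the mean of the unobserved potential
outcome. -/
lemma IsUnmeasuredConfounder.setIntegral_sub_thetaPlus_nonpos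
    (h : IsUnmeasuredConfounder P X A Ypot W)
    (hX : Measurable X) (hA : Measurable A) (hY : Measurable Y)
    (hYpot : ∀ a, Measurable (Ypot a)) (hW : Measurable W) (hint : ∀ a, Integrable (Ypot a) P)
    (hcons : Consistency P A Y Ypot) (hpos : Positivity P A X) {b : ℝ} (hb : 0 ≤ b)
    (hodds : oddsConfounding P A X W ≤ ENNReal.ofReal b) (a : Fin 2) :
    ∫ ω in A ⁻¹' {1 - a}, (Ypot a ω - thetaPlus P X A Y a (Real.exp b) (X ω)) ∂P ≤ 0 := by
  have ht : 1 ≤ Real.exp b := Real.one_le_exp hb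
  have hi := hpos.ae_integrable_condLaw hA hX hY (hcons.integrable hY hint) a
  have hs := aemeasurable_thetaPlus (Y := Y) (t := Real.exp b) ht a hi
  have hsi := hpos.integrable_thetaPlus hA hX hY (hcons.integrable hY hint) ht a
  refine integral_sub_nonpos_of_lintegral_le (hint a).restrict hsi.restrict ?_
  have hm : Measurable (hs.mk _) := hs.measurable_mk
  -- Here `f` and `g` are the positive and negative parts of `Y^a - θ^+`, and their balance on the
  -- arm `a` is the root equation. A measurable version replaces `θ^+`, which is only almost
  -- everywhere measurable.
  have key := h.setLIntegral_le hX hA hY hYpot hW hcons hb hodds a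
    (f := fun z => ENNReal.ofReal (z.2 - hs.mk _ z.1))
    (g := fun z => ENNReal.ofReal (hs.mk _ z.1 - z.2)) (by fun_prop) (by fun_prop) ?_ ?_
  · have e := ae_restrict_of_ae (s := A ⁻¹' {1 - a}) (ae_of_ae_map hX.aemeasurable hs.ae_eq_mk)
    refine (lintegral_congr_ae ?_).trans_le (key.trans_eq (lintegral_congr_ae ?_))
    · exact e.mono fun ω hω => by simp only [hω]
    · exact e.mono fun ω hω => by simp only [hω]
  · filter_upwards [hi, hs.ae_eq_mk] with x hx hxs
    simp only [← hxs]
    exact lintegral_maxTiltedMean hx ht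
  · filter_upwards [hi] with x hx
    exact (lintegral_ofReal_sub_ne_top hx _).2

/-- Under the odds ratio model, imputing `θ^-` understates the mean of the unobserved potential
outcome. -/
lemma IsUnmeasuredConfounder.setIntegral_sub_thetaMinus_nonneg
    (h : IsUnmeasuredConfounder P X A Ypot W)
    (hX : Measurable X) (hA : Measurable A) (hY : Measurable Y)
    (hYpot : ∀ a, Measurable (Ypot a)) (hW : Measurable W) (hint : ∀ a, Integrable (Ypot a) P)
    (hcons : Consistency P A Y Ypot) (hpos : Positivity P A X) {b : ℝ} (hb : 0 ≤ b)
    (hodds : oddsConfounding P A X W ≤ ENNReal.ofReal b) (a : Fin 2) :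
    0 ≤ ∫ ω in A ⁻¹' {1 - a}, (Ypot a ω - thetaMinus P X A Y a (Real.exp b) (X ω)) ∂P := by
  have ht : 1 ≤ Real.exp b := Real.one_le_exp hb
  have hi := hpos.ae_integrable_condLaw hA hX hY (hcons.integrable hY hint) a
  have hs := aemeasurable_thetaMinus (Y := Y) (t := Real.exp b) ht a hi
  have hsi := hpos.integrable_thetaMinus hA hX hY (hcons.integrable hY hint) ht a
  rw [← neg_nonpos, ← integral_neg]
  simp only [neg_sub]
  refine integral_sub_nonpos_of_lintegral_le hsi.restrict (hint a).restrict ?_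
  have hm : Measurable (hs.mk _) := hs.measurable_mk
  have key := h.setLIntegral_le hX hA hY hYpot hW hcons hb hodds a
    (f := fun z => ENNReal.ofReal (hs.mk _ z.1 - z.2))
    (g := fun z => ENNReal.ofReal (z.2 - hs.mk _ z.1)) (by fun_prop) (by fun_prop) ?_ ?_
  · have e := ae_restrict_of_ae (s := A ⁻¹' {1 - a}) (ae_of_ae_map hX.aemeasurable hs.ae_eq_mk)
    refine (lintegral_congr_ae ?_).trans_le (key.trans_eq (lintegral_congr_ae ?_))
    · exact e.mono fun ω hω => by simp only [hω]
    · exact e.mono fun ω hω => by simp only [hω]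
  · filter_upwards [hi, hs.ae_eq_mk] with x hx hxs
    simp only [← hxs]
    exact lintegral_minTiltedMean hx ht
  · filter_upwards [hi] with x hx
    exact (lintegral_ofReal_sub_ne_top hx _).1

/-- Bounds on the effect under the odds ratio model. -/
lemma OddsModel.ate_mem {Γ : ℝ} (h : OddsModel P X A Ypot W Γ)
    (hX : Measurable X) (hA : Measurable A) (hY : Measurable Y)
    (hYpot : ∀ a, Measurable (Ypot a)) (hW : Measurable W) (hint : ∀ a, Integrable (Ypot a) P)
    (hcons : Consistency P A Y Ypot) (hpos : Positivity P A X) (hΓ : 0 ≤ Γ) :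
    ∫ ω, oddsLowerIntegrand P X A Y
        (Real.exp (Γ * (measuredOddsConfounding P X A).toReal)) ω ∂P ≤ ate P Ypot ∧
      ate P Ypot ≤ ∫ ω, oddsUpperIntegrand P X A Y
        (Real.exp (Γ * (measuredOddsConfounding P X A).toReal)) ω ∂P := by
  obtain ⟨hconf, hodds⟩ := h
  have hM := measuredOddsConfounding_lt_top hX hA hpos
  set b := Γ * (measuredOddsConfounding P X A).toReal with hb_def
  have hb : 0 ≤ b := mul_nonneg hΓ ENNReal.toReal_nonneg
  have hodds' : oddsConfounding P A X W ≤ ENNReal.ofReal b := by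
    rwa [hb_def, ENNReal.ofReal_mul hΓ, ENNReal.ofReal_toReal hM.ne]
  have ht : 1 ≤ Real.exp b := Real.one_le_exp hb
  have hi := hcons.integrable hY hint
  have hp := hconf.setIntegral_sub_thetaPlus_nonpos hX hA hY hYpot hW hint hcons hpos hb hodds'
  have hm := hconf.setIntegral_sub_thetaMinus_nonneg hX hA hY hYpot hW hint hcons hpos hb hodds'
  have p0 := hp 0
  have p1 := hp 1
  have m0 := hm 0
  have m1 := hm 1
  simp only [sub_self, sub_zero] at p0 p1 m0 m1
  have hl := hcons.ate_sub_integral hA hint (hpos.integrable_thetaPlus hA hX hY hi ht 0)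
    (hpos.integrable_thetaMinus hA hX hY hi ht 1)
    (hpos.integrable_oddsLowerIntegrand hA hX hY hi ht) (fun ω => rfl)
  have hu := hcons.ate_sub_integral hA hint (hpos.integrable_thetaMinus hA hX hY hi ht 0)
    (hpos.integrable_thetaPlus hA hX hY hi ht 1)
    (hpos.integrable_oddsUpperIntegrand hA hX hY hi ht) (fun ω => rfl)
  constructor <;> linarith

end Theta

/-! ### Bias formula and Cauchy–Schwarz for the outcome model. -/

section OutcomeBounds

variable {Ω : Type*} [MeasurableSpace Ω] {P : Measure Ω} [IsProbabilityMeasure P] {d : ℕ}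
  {X : Ω → Fin d → ℝ} {A : Ω → Fin 2} {Y : Ω → ℝ} {Ypot : Fin 2 → Ω → ℝ}

lemma integrable_propensity_mul (hX : Measurable X) (a : Fin 2) {f : Ω → ℝ} (hf : Integrable f P) :
    Integrable (fun ω => propensity P A X a (X ω) * f ω) P := by
  refine hf.bdd_mul ((measurable_propensity a).comp hX).aestronglyMeasurable (c := 1)
    (ae_of_all _ fun ω => ?_)
  rw [Real.norm_eq_abs, abs_of_nonneg (propensity_nonneg _ _)]
  exact propensity_le_one _ _

/-- The mean of a potential outcome as the adjusted mean plus the bias from confounding. -/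
lemma Positivity.integral_sub_integral_condMean {T : Ω → ℝ} (hpos : Positivity P A X)
    (hX : Measurable X) (hA : Measurable A) (hT : Measurable T) (hi : Integrable T P) (a : Fin 2) :
    ∫ ω, T ω ∂P - ∫ ω, condMean P A X T a (X ω) ∂P =
      -∫ ω, propensity P A X (1 - a) (X ω) *
        (condMean P A X T a (X ω) - condMean P A X T (1 - a) (X ω)) ∂P := by
  have hm := fun c => hpos.integrable_condMean hA hX hT c hi.restrict
  have hs : ∫ ω, T ω ∂P = ∫ ω in A ⁻¹' {a}, T ω ∂P + ∫ ω in A ⁻¹' {1 - a}, T ω ∂P := by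
    rw [← integral_add_compl (hA (measurableSet_singleton a)) hi]
    congr 3
    ext ω
    simp only [Set.mem_compl_iff, Set.mem_preimage, Set.mem_singleton_iff]
    generalize A ω = c
    fin_cases a <;> fin_cases c <;> simp
  rw [hs, setIntegral_arm hA hX hT a hi.restrict, setIntegral_arm hA hX hT (1 - a) hi.restrict,
    ← integral_add (integrable_propensity_mul hX _ (hm a))
      (integrable_propensity_mul hX _ (hm (1 - a))), ← integral_sub
      (f := fun ω => propensity P A X a (X ω) * condMean P A X T a (X ω) +
        propensity P A X (1 - a) (X ω) * condMean P A X T (1 - a) (X ω))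
      ((integrable_propensity_mul hX _ (hm a)).add (integrable_propensity_mul hX _ (hm (1 - a))))
      (hm a), ← integral_neg]
  refine integral_congr_ae (ae_of_all _ fun ω => ?_)
  simp only
  -- Each arm `c` contributes the mean of `π_c(X) E(T | A = c, X)`; substituting `π_a = 1 - π_{1-a}`
  -- leaves the bias term alone.
  rw [eq_sub_of_add_eq (propensity_add a (X ω))]
  ring

/-- Cauchy–Schwarz, stated in `[0, ∞]` so that `f` need not be square integrable. -/
lemma enorm_integral_propensity_mul_le (hX : Measurable X) (a : Fin 2) {f : Ω → ℝ}
    (hf : AEStronglyMeasurable f P) :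
    ‖∫ ω, propensity P A X a (X ω) * f ω ∂P‖ₑ ≤
      eLpNorm (fun ω => propensity P A X a (X ω)) 2 P * eLpNorm f 2 P := by
  have h := eLpNorm_smul_le_mul_eLpNorm (p := 2) (q := 2) (r := 1) hf
    (((measurable_propensity (P := P) (A := A) (V := X) a).comp hX).aestronglyMeasurable (μ := P))
  refine (enorm_integral_le_lintegral_enorm _).trans ?_
  rwa [eLpNorm_one_eq_lintegral_enorm] at h

/-- The bias of the adjusted mean difference, bounded by confounding of the outcome. -/
lemma Positivity.enorm_ate_sub_adjDiff_le (hpos : Positivity P A X)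
    (hX : Measurable X) (hA : Measurable A) (hY : Measurable Y)
    (hYpot : ∀ a, Measurable (Ypot a)) (hint : ∀ a, Integrable (Ypot a) P)
    (hcons : Consistency P A Y Ypot) :
    ‖ate P Ypot - adjDiff P A X Y‖ₑ ≤ ∑ a : Fin 2,
      eLpNorm (fun ω => propensity P A X (1 - a) (X ω)) 2 P *
        eLpNorm (fun ω => condMean P A X (Ypot a) a (X ω) - condMean P A X (Ypot a) (1 - a) (X ω))
          2 P := by
  have hcm : ∀ a, ∀ᵐ ω ∂P, condMean P A X Y a (X ω) = condMean P A X (Ypot a) a (X ω) := fun a =>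
    ae_of_ae_map hX.aemeasurable (condMean_congr hA hX hY (hYpot a) a
      (hcons.mono fun ω hω => hω a) (hpos.ne_zero hX a))
  have hm := fun a c => hpos.integrable_condMean hA hX (hYpot a) c (hint a).restrict
  have hadj : adjDiff P A X Y = ∫ ω, condMean P A X (Ypot 1) 1 (X ω) ∂P -
      ∫ ω, condMean P A X (Ypot 0) 0 (X ω) ∂P := by
    rw [adjDiff, ← integral_sub (hm 1 1) (hm 0 0)]
    refine integral_congr_ae ?_
    filter_upwards [hcm 0, hcm 1] with ω h0 h1
    rw [h0, h1]
  have h1 := hpos.integral_sub_integral_condMean hX hA (hYpot 1) (hint 1) 1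
  have h0 := hpos.integral_sub_integral_condMean hX hA (hYpot 0) (hint 0) 0
  have hb := fun a => enorm_integral_propensity_mul_le (P := P) (A := A) hX (1 - a)
    ((hm a a).sub (hm a (1 - a))).aestronglyMeasurable
  have e : ate P Ypot - adjDiff P A X Y =
      (∫ ω, propensity P A X (1 - 0) (X ω) *
        (condMean P A X (Ypot 0) 0 (X ω) - condMean P A X (Ypot 0) (1 - 0) (X ω)) ∂P) -
      ∫ ω, propensity P A X (1 - 1) (X ω) *
        (condMean P A X (Ypot 1) 1 (X ω) - condMean P A X (Ypot 1) (1 - 1) (X ω)) ∂P := by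
    rw [ate, hadj, integral_sub (hint 1) (hint 0)]
    linarith
  rw [e, Fin.sum_univ_two]
  exact (enorm_sub_le).trans (add_le_add (hb 0) (hb 1))

/-- The multiplier is written as a square to serve both versions of the model: `c = √Γ` for squared
norms and `c = Γ` for norms. -/
lemma OutcomeModel.enorm_ate_sub_adjDiff_le {𝒮 : Finset (Finset (Fin d))} {c : ℝ}
    (h : OutcomeModel P X A Y Ypot 𝒮 (c ^ 2)) (hc : 0 ≤ c) (hpos : Positivity P A X)
    (hX : Measurable X) (hA : Measurable A) (hY : Measurable Y)
    (hYpot : ∀ a, Measurable (Ypot a)) (hint : ∀ a, Integrable (Ypot a) P)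
    (hcons : Consistency P A Y Ypot) :
    ‖ate P Ypot - adjDiff P A X Y‖ₑ ≤ outcomeRadius P X A Y 𝒮 c := by
  refine (hpos.enorm_ate_sub_adjDiff_le hX hA hY hYpot hint hcons).trans ?_
  rw [outcomeRadius, Finset.mul_sum]
  refine Finset.sum_le_sum fun a _ => ?_
  rw [mul_left_comm]
  gcongr
  have h2 := ENNReal.rpow_le_rpow (h a) (by norm_num : (0 : ℝ) ≤ 1 / 2)
  rw [ENNReal.mul_rpow_of_nonneg _ _ (by norm_num), ENNReal.ofReal_pow hc] at h2
  simp only [← ENNReal.rpow_natCast, ← ENNReal.rpow_mul] at h2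
  simpa using h2

lemma ereal_bounds_of_enorm_sub_le {x y : ℝ} {r : ℝ≥0∞} (h : ‖y - x‖ₑ ≤ r) :
    (x : EReal) - (r : EReal) ≤ (y : EReal) ∧ (y : EReal) ≤ (x : EReal) + (r : EReal) := by
  induction r with
  | top => simp
  | coe r =>
    rw [← ofReal_norm, Real.norm_eq_abs, ← ENNReal.ofReal_coe_nnreal,
      ENNReal.ofReal_le_ofReal_iff (NNReal.coe_nonneg r), abs_le] at h
    have e : (((r : ℝ≥0∞) : ℝ≥0∞) : EReal) = ((r : ℝ) : EReal) := rfl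
    rw [e, ← EReal.coe_sub, ← EReal.coe_add, EReal.coe_le_coe_iff, EReal.coe_le_coe_iff]
    constructor <;> linarith [h.1, h.2]

end OutcomeBounds

end CalibratedSensitivity

end

theorem mainTheorem3 {Ω 𝓦 : Type*} [MeasurableSpace Ω] [MeasurableSpace 𝓦]
    [StandardBorelSpace 𝓦] [Nonempty 𝓦] (P : Measure Ω) [IsProbabilityMeasure P]
    {d : ℕ} (X : Ω → Fin d → ℝ) (A : Ω → Fin 2) (Y : Ω → ℝ) (Ypot : Fin 2 → Ω → ℝ) (W : Ω → 𝓦)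
    (hX : Measurable X) (hA : Measurable A) (hY : Measurable Y)
    (hYpot : ∀ a, Measurable (Ypot a)) (hW : Measurable W)
    (hint : ∀ a, Integrable (Ypot a) P)
    (hcons : Consistency P A Y Ypot) (hpos : Positivity P A X)
    (Γ : ℝ) (hΓ : 0 < Γ) :
    -- maximum leave-one-out effect differences model
    (EffectModel P X A Y Ypot Γ ↔
      adjDiff P A X Y - Γ * effectConfounding P X A Y ≤ ate P Ypot ∧
        ate P Ypot ≤ adjDiff P A X Y + Γ * effectConfounding P X A Y) ∧
    -- maximum leave-one-out odds ratio model
    (measuredOddsConfounding P X A < ∞ ∧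
      Integrable
        (oddsLowerIntegrand P X A Y (Real.exp (Γ * (measuredOddsConfounding P X A).toReal))) P ∧
      Integrable
        (oddsUpperIntegrand P X A Y (Real.exp (Γ * (measuredOddsConfounding P X A).toReal))) P ∧
      (OddsModel P X A Ypot W Γ →
        ∫ ω, oddsLowerIntegrand P X A Y
            (Real.exp (Γ * (measuredOddsConfounding P X A).toReal)) ω ∂P ≤ ate P Ypot ∧
          ate P Ypot ≤ ∫ ω, oddsUpperIntegrand P X A Y
            (Real.exp (Γ * (measuredOddsConfounding P X A).toReal)) ω ∂P)) ∧
    -- average leave-some-out outcome model, with multiplier `Γ` of the squared norms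
    -- and with multiplier `Γ` of the norms
    (∀ 𝒮 : Finset (Finset (Fin d)), 𝒮.Nonempty →
      (OutcomeModel P X A Y Ypot 𝒮 Γ →
        (adjDiff P A X Y : EReal) - (outcomeRadius P X A Y 𝒮 (Real.sqrt Γ) : EReal)
            ≤ (ate P Ypot : EReal) ∧
          (ate P Ypot : EReal)
            ≤ (adjDiff P A X Y : EReal) + (outcomeRadius P X A Y 𝒮 (Real.sqrt Γ) : EReal)) ∧
      (OutcomeModel P X A Y Ypot 𝒮 (Γ ^ 2) →
        (adjDiff P A X Y : EReal) - (outcomeRadius P X A Y 𝒮 Γ : EReal) ≤ (ate P Ypot : EReal) ∧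
          (ate P Ypot : EReal)
            ≤ (adjDiff P A X Y : EReal) + (outcomeRadius P X A Y 𝒮 Γ : EReal))) := by
  have hYi := hcons.integrable hY hint
  have hM := measuredOddsConfounding_lt_top hX hA hpos
  have ht : 1 ≤ Real.exp (Γ * (measuredOddsConfounding P X A).toReal) :=
    Real.one_le_exp (mul_nonneg hΓ.le ENNReal.toReal_nonneg)
  refine ⟨?_, ⟨hM, hpos.integrable_oddsLowerIntegrand hA hX hY hYi ht,
    hpos.integrable_oddsUpperIntegrand hA hX hY hYi ht,
    fun h => h.ate_mem hX hA hY hYpot hW hint hcons hpos hΓ.le⟩, fun 𝒮 _ => ⟨fun h => ?_, fun h => ?_⟩⟩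
  · rw [EffectModel, abs_le]
    constructor <;> rintro ⟨h1, h2⟩ <;> constructor <;> linarith
  · rw [← Real.sq_sqrt hΓ.le] at h
    exact ereal_bounds_of_enorm_sub_le
      (h.enorm_ate_sub_adjDiff_le (Real.sqrt_nonneg Γ) hpos hX hA hY hYpot hint hcons)
  · exact ereal_bounds_of_enorm_sub_le
      (h.enorm_ate_sub_adjDiff_le hΓ.le hpos hX hA hY hYpot hint hcons)
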